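/- Let $G=(V,E)$ be a finite polytree, i.e. a directed acyclic graph whose underlying undirected graph is a tree, and let $\mathbb{K}\in\{\mathbb{R},\mathbb{C}\}$. The third-order moment model $\mathcal M^{\le 3}(G)$ is the set of all pairs $(S,T)$ with $$S=(I-\Lambda)^{-T}\,\Omega^{(2)}\,(I-\Lambda)^{-1},\qquad T_{ijk}=\sum_{a,b,c\in V}\Omega^{(3)}_{abc}\,[(I-\Lambda)^{-1}]_{ai}\,[(I-\Lambda)^{-1}]_{bj}\,[(I-\Lambda)^{-1}]_{ck},$$ where $\Lambda\in\mathbb{R}^{V\times V}$ satisfies $\Lambda_{ij}=0$ whenever $i\to j\notin E$, $\Omega^{(2)}\in\mathbb{R}^{V\times V}$ is diagonal and positive definite, and $\Omega^{(3)}\in\mathbb{R}^{V\times V\times V}$ is diagonal. Let $\mathcal I^{\le 3}(G)$ be the ideal of all polynomials over $\mathbb{K}$ in the entries $s_{ij}=s_{ji}$ of a symmetric matrix and the entries $t_{ijk}$ of a symmetric tensor that vanish on $\mathcal M^{\le 3}(G)$. A $k$-trek between $i_1,\dots,i_k\in V$ is a tuple $(P_1,\dots,P_k)$ of directed paths, possibly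 of length $0$, with a common source (the top of the trek), where $P_r$ has sink $i_r$. It is simple if its top is the only vertex lying on all the $P_r$. In a polytree there is, if a $k$-trek between $i_1,\dots,i_k$ exists, exactly one simple one; its top is denoted $\operatorname{top}(i_1,\dots,i_k)$. For $i,j\in V$ between which a 2-trek exists, the trek-matrix $A_{i,j}$ is the matrix with two rows whose columns are all $\binom{s_{ik}}{s_{jk}}$ with $\operatorname{top}(i,k)=\operatorname{top}(j,k)$ and all $\binom{t_{ilm}}{t_{jlm}}$ with $\operatorname{top}(i,l,m)=\operatorname{top}(j,l,m)$ (where both tops are required to exist). Let $I_G$ be the ideal generated by the indeterminates $s_{ij}$ for which there is no 2-trek between $i,j$, the indeterminates $t_{ijk}$ for which there is no 3-trek between $i,j,k$, and the 2-minors of all trek-matrices $A_{i,j}$. Then $$\mathcal I^{\le 3}(G)=I_G .$$ In particular, $\mathcal I^{\le 3}(G)$ is generated by linear forms (the indeterminates above) and quadratic binomials (the 2-minors, each a difference of two monomials of degree 2), and these generators form a Markov basis of $\mathcal I^{\le 3}(G)$: every monomial in $\mathcal I^{\le 3}(G)$ is divisible by one of these indeterminates, and any two monomials $x^u,x^v\notin\mathcal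 I^{\le 3}(G)$ with $x^u-x^v\in\mathcal I^{\le 3}(G)$ are connected by a finite sequence of moves between monomials, each replacing $x^{c}x^{a}$ by $x^{c}x^{b}$, where $x^a-x^b$ or $x^b-x^a$ is a 2-minor of a trek-matrix. -/

import Mathlib

namespace ThirdMoment

noncomputable section

open MvPolynomial

variable {V : Type*}

/-! ### Polytrees -/

/-- A directed graph is acyclic if it has no closed directed path of positive length. -/
def IsAcyclic (G : Digraph V) : Prop :=
  ∀ v, ¬ Relation.TransGen G.Adj v v

/-- A polytree is a directed acyclic graph whose underlying undirected graph is a tree. -/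
def IsPolytree (G : Digraph V) : Prop :=
  IsAcyclic G ∧ G.toSimpleGraphInclusive.IsTree

/-! ### The third-order moment model -/

/-- `Λ ∈ ℝ^E`: the entries of `Λ` outside the edge set are zero. -/
def IsEdgeWeight (G : Digraph V) (Λ : Matrix V V ℝ) : Prop :=
  ∀ i j, ¬ G.Adj i j → Λ i j = 0

/-- A `V × V × V` tensor is diagonal if its entries off the diagonal `i = j = k` vanish. -/
def IsDiagTensor (T : V → V → V → ℝ) : Prop :=
  ∀ i j k, ¬ (i = j ∧ j = k) → T i j k = 0

/-- The Tucker product `T • A • B • C`. -/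
def tucker [Fintype V] (T : V → V → V → ℝ) (A B C : Matrix V V ℝ) : V → V → V → ℝ :=
  fun i j k => ∑ a, ∑ b, ∑ c, T a b c * A a i * B b j * C c k

/-- The third-order moment model of `G`: all pairs of a covariance matrix and a third moment
tensor that arise from the linear structural equation model `X = Λᵀ X + ε`, where `Ω₂` and `Ω₃`
are the covariance matrix and the third moment tensor of `ε`. -/
def momentModel [Fintype V] [DecidableEq V] (G : Digraph V) :
    Set (Matrix V V ℝ × (V → V → V → ℝ)) :=
  {ST | ∃ (Λ Ω₂ : Matrix V V ℝ) (Ω₃ : V → V → V → ℝ),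
    IsEdgeWeight G Λ ∧ Ω₂.PosDef ∧ Ω₂.IsDiag ∧ IsDiagTensor Ω₃ ∧
    ST.1 = ((1 - Λ)⁻¹).transpose * Ω₂ * (1 - Λ)⁻¹ ∧
    ST.2 = tucker Ω₃ (1 - Λ)⁻¹ (1 - Λ)⁻¹ (1 - Λ)⁻¹}

/-! ### The polynomial ring in the entries of a symmetric matrix and a symmetric tensor -/

/-- Indices of the indeterminates: unordered pairs for the `s_ij`, unordered triples for the
`t_ijk`. -/
abbrev MomentVar (V : Type*) : Type _ := Sym2 V ⊕ Sym V 3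

/-- The index of `s_ij`. -/
def sVar (i j : V) : MomentVar V := Sum.inl s(i, j)

/-- The index of `t_ijk`. -/
def tVar (i j k : V) : MomentVar V := Sum.inr (i ::ₛ j ::ₛ k ::ₛ Sym.nil)

/-- The points of the model in the coordinates `s_ij`, `t_ijk`, with values in `𝕜 = ℝ` or `ℂ`. -/
def modelPoints (𝕜 : Type*) [RCLike 𝕜] [Fintype V] [DecidableEq V] (G : Digraph V) :
    Set (MomentVar V → 𝕜) :=
  {p | ∃ ST ∈ momentModel G,
    (∀ i j, p (sVar i j) = ((ST.1 i j : ℝ) : 𝕜)) ∧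
    ∀ i j k, p (tVar i j k) = ((ST.2 i j k : ℝ) : 𝕜)}

/-- The third-order moment ideal of `G`: the polynomials that vanish on the model. -/
def momentIdeal (𝕜 : Type*) [RCLike 𝕜] [Fintype V] [DecidableEq V] (G : Digraph V) :
    Ideal (MvPolynomial (MomentVar V) 𝕜) :=
  vanishingIdeal 𝕜 (modelPoints 𝕜 G)

/-! ### Treks -/

/-- `l` is the list of vertices of a directed path from `v` to `w` (possibly of length zero).
In an acyclic graph the vertices of such a list are automatically distinct. -/
def IsDirectedPath (G : Digraph V) (v w : V) (l : List V) : Prop :=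
  l.IsChain G.Adj ∧ l.head? = some v ∧ l.getLast? = some w

/-- A `k`-trek between `i 0, …, i (k - 1)`: directed paths with a common source, the top,
the `r`-th of which has sink `i r`. -/
structure Trek (G : Digraph V) {k : ℕ} (i : Fin k → V) where
  top : V
  path : Fin k → List V
  isDirectedPath : ∀ r, IsDirectedPath G top (i r) (path r)

/-- A trek is simple if its top is the only vertex lying on all of its paths. -/
def Trek.IsSimple {G : Digraph V} {k : ℕ} {i : Fin k → V} (τ : Trek G i) : Prop :=
  ∀ v, (∀ r, v ∈ τ.path r) → v = τ.top

/-- There is a trek between the given vertices. -/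
def HasTrek (G : Digraph V) {k : ℕ} (i : Fin k → V) : Prop := Nonempty (Trek G i)

/-- `v = top(i 0, …, i (k - 1))`: the vertex `v` is the top of a simple trek between the given
vertices. In a polytree there is at most one simple trek between given vertices, so that `v` is
determined by them. -/
def IsTop (G : Digraph V) {k : ℕ} (i : Fin k → V) (v : V) : Prop :=
  ∃ τ : Trek G i, τ.IsSimple ∧ τ.top = v

/-- The tops of the two families exist and are equal. -/
def SameTop (G : Digraph V) {k : ℕ} (i j : Fin k → V) : Prop :=
  ∃ v, IsTop G i v ∧ IsTop G j v

/-! ### Trek-matrices and the ideal they generate -/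

/-- The columns of the trek-matrix `A_{i,j}`: the vertices `k` with `top(i,k) = top(j,k)`, and the
pairs `(l,m)` with `top(i,l,m) = top(j,l,m)`. -/
abbrev TrekColumn (G : Digraph V) (i j : V) : Type _ :=
  {k : V // SameTop G ![i, k] ![j, k]} ⊕
    {lm : V × V // SameTop G ![i, lm.1, lm.2] ![j, lm.1, lm.2]}

/-- The indeterminate in the row of the vertex `i` and the given column. -/
def trekEntry {G : Digraph V} {i j : V} (r : V) : TrekColumn G i j → MomentVar V
  | Sum.inl k => sVar r k.1
  | Sum.inr lm => tVar r lm.1.1 lm.1.2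

/-- The trek-matrix `A_{i,j}`. -/
def trekMatrix (𝕜 : Type*) [CommRing 𝕜] (G : Digraph V) (i j : V) :
    Matrix (Fin 2) (TrekColumn G i j) (MvPolynomial (MomentVar V) 𝕜) :=
  Matrix.of fun r c => X (trekEntry (![i, j] r) c)

/-- The indeterminates `s_ij` and `t_ijk` for which there is no 2-trek between `i, j`,
respectively no 3-trek between `i, j, k`. -/
def linearGenerators (𝕜 : Type*) [CommRing 𝕜] (G : Digraph V) :
    Set (MvPolynomial (MomentVar V) 𝕜) :=
  {f | ∃ i j, ¬ HasTrek G ![i, j] ∧ f = X (sVar i j)} ∪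
    {f | ∃ i j k, ¬ HasTrek G ![i, j, k] ∧ f = X (tVar i j k)}

/-- The 2-minors of all trek-matrices `A_{i,j}`, where `i` and `j` are joined by a 2-trek. -/
def trekMinors (𝕜 : Type*) [CommRing 𝕜] (G : Digraph V) :
    Set (MvPolynomial (MomentVar V) 𝕜) :=
  {f | ∃ i j, HasTrek G ![i, j] ∧ ∃ c d : TrekColumn G i j,
    f = ((trekMatrix 𝕜 G i j).submatrix id ![c, d]).det}

/-- The ideal `I_G`. -/
def trekIdeal (𝕜 : Type*) [CommRing 𝕜] (G : Digraph V) : Ideal (MvPolynomial (MomentVar V) 𝕜) :=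
  Ideal.span (linearGenerators 𝕜 G ∪ trekMinors 𝕜 G)

/-! ### Markov bases -/

/-- A difference of two monomials of degree two (possibly zero, as for a minor with two equal
columns). -/
def IsQuadraticBinomial {σ 𝕜 : Type*} [CommRing 𝕜] (f : MvPolynomial σ 𝕜) : Prop :=
  ∃ u v : σ →₀ ℕ, u.degree = 2 ∧ v.degree = 2 ∧ f = monomial u 1 - monomial v 1

/-- One move along a binomial `x^a - x^b` of `B`, from the exponent `c + a` to `c + b`. -/
def MarkovMove {σ 𝕜 : Type*} [CommRing 𝕜] (B : Set (MvPolynomial σ 𝕜)) (u v : σ →₀ ℕ) : Prop :=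
  ∃ a b c : σ →₀ ℕ, monomial a 1 - monomial b 1 ∈ B ∧ u = c + a ∧ v = c + b

/-- A set `B` of monomials and binomials is a Markov basis of the ideal `I` if it lies in `I`,
every monomial of `I` is divisible by a monomial of `B`, and each fiber of `I` (a class of
monomials outside `I` that are congruent modulo `I`) is connected by the moves along the
binomials of `B`, in both directions, through exponents with nonnegative entries. For a toric
ideal, given by an exponent matrix `A`, the fibers are the sets `{v ∈ ℕ^σ | A v = A u}`. -/
def IsMarkovBasis {σ 𝕜 : Type*} [CommRing 𝕜] (B : Set (MvPolynomial σ 𝕜))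
    (I : Ideal (MvPolynomial σ 𝕜)) : Prop :=
  (∀ f ∈ B, f ∈ I ∧ ((∃ u, f = monomial u 1) ∨ ∃ u v, f = monomial u 1 - monomial v 1)) ∧
  (∀ u : σ →₀ ℕ, monomial u (1 : 𝕜) ∈ I → ∃ a ≤ u, monomial a (1 : 𝕜) ∈ B) ∧
  ∀ u v : σ →₀ ℕ, monomial u (1 : 𝕜) ∉ I → monomial v (1 : 𝕜) ∉ I →
    monomial u (1 : 𝕜) - monomial v 1 ∈ I → Relation.EqvGen (MarkovMove B) u v

end

end ThirdMoment

/-! In a polytree, reachability is a partial order whose covers are exactly the edges, each interval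
is a chain, and vertices with a common lower bound have a greatest one (`exists_isMeet`). The top of
a simple trek is this meet (`IsPolytree.isTop_iff`).

Every path from a vertex `u` below `v = top(i, j)` to `i` or `j` runs through `v`. Hence `s_ij` is
the variance `s_vv` times the edge weights on the paths from `v` to `i` and `j`, and likewise for
`t_ijk` (`sum_mul_prod_pathMatrix`). The diagonal moments can be prescribed freely, up to positivity
of the noise variances, so the model lies in the image of a monomial map and contains the image of a
product of intervals. The moment ideal is therefore the kernel of that map, `trekMap`
(`IsPolytree.momentIdeal_eq_ker`).

It remains to connect any two monomials with the same nonzero image (`exchanges_of_weight_eq`). A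
monomial is a multiset of boxes, each holding two or three vertices. A 2-minor swaps an element `i`
of one box with an element `j` of another without changing the two meets. The image of the monomial
determines the sizes and meets of the boxes and, at each vertex `w`, how many paths go on along each
edge or end there. Choose a meet `v` with no other meet strictly above it. A greedy choice,
depending on these counts only, fixes the branches at `v` of one box with meet `v`, in both
monomials alike (`exists_normal_branches`). Above `v` no path starts, so two paths through `w > v`
can swap their ends freely, and the two boxes are made equal step by step
(`exists_exchanges_box_eq`). Cancel them and induct on the number of boxes. -/

namespace ThirdMoment

/-! ### Polyforest orders: branches and meets -/

/-- A partial order whose Hasse diagram, as an undirected graph, has no cycles, stated in the form: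
if two covers of `v` lie below `i` and `j`, then every common lower bound of `i` and `j` lies
below `v`. -/
class IsPolyforest (V : Type*) [PartialOrder V] : Prop where
  le_of_branch : ∀ {v c c' i j w : V}, v ⋖ c → v ⋖ c' → c ≠ c' → c ≤ i → c' ≤ j →
    w ≤ i → w ≤ j → w ≤ v

section Order

variable {V : Type*} [PartialOrder V] [IsPolyforest V]

/-- This is uniqueness of directed paths: in `le_of_branch` take both ends equal to `e` and `c` as
the lower bound. -/
theorem covBy_unique {u c c' e : V} (h : u ⋖ c) (h' : u ⋖ c') (hc : c ≤ e) (hc' : c' ≤ e) :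
    c = c' := by
  by_contra hne
  exact absurd (IsPolyforest.le_of_branch h h' hne hc hc' hc hc) h.lt.not_ge

/-- The cover of `v` below `i`, or `v` itself if there is none. -/
noncomputable def branch (v i : V) : V :=
  open Classical in if h : ∃ c, v ⋖ c ∧ c ≤ i then h.choose else v

theorem branch_eq_of_covBy {v c i : V} (h : v ⋖ c) (hc : c ≤ i) : branch v i = c := by
  have hex : ∃ c, v ⋖ c ∧ c ≤ i := ⟨c, h, hc⟩
  rw [branch, dif_pos hex]
  exact covBy_unique hex.choose_spec.1 h hex.choose_spec.2 hc

omit [IsPolyforest V] in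
theorem branch_self (v : V) : branch v v = v := by
  rw [branch, dif_neg]
  rintro ⟨c, h, hc⟩
  exact h.lt.not_ge hc

variable [Finite V]

theorem branch_spec {v i : V} (h : v < i) : v ⋖ branch v i ∧ branch v i ≤ i := by
  obtain ⟨c, h1, h2⟩ := exists_covBy_le_of_lt h
  rw [branch_eq_of_covBy h1 h2]
  exact ⟨h1, h2⟩

theorem branch_eq_self_iff {v i : V} (h : v ≤ i) : branch v i = v ↔ i = v := by
  constructor
  · intro hb
    by_contra hne
    have := (branch_spec (lt_of_le_of_ne h (Ne.symm hne))).1.lt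
    exact absurd hb this.ne'
  · rintro rfl
    exact branch_self _

theorem branch_eq_or_covBy {v i : V} (h : v ≤ i) :
    (branch v i = v ∧ i = v) ∨ (v ⋖ branch v i ∧ branch v i ≤ i) := by
  rcases h.eq_or_lt with rfl | h
  · exact Or.inl ⟨branch_self _, rfl⟩
  · exact Or.inr (branch_spec h)

theorem branch_le {v i : V} (h : v ≤ i) : branch v i ≤ i := by
  rcases branch_eq_or_covBy h with ⟨h1, h2⟩ | h1
  · rw [h1, h2]
  · exact h1.2

theorem branch_eq_of_lt {v w i : V} (h : v < w) (hi : w ≤ i) : branch v i = branch v w :=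
  branch_eq_of_covBy (branch_spec h).1 ((branch_spec h).2.trans hi)

theorem branch_eq_iff_of_covBy {v c i : V} (h : v ⋖ c) (hi : v ≤ i) :
    branch v i = c ↔ c ≤ i := by
  constructor
  · rintro rfl
    exact branch_le hi
  · exact branch_eq_of_covBy h

/-- Unless one of them is `s`, both elements lie above the only cover of `s` below `e`, and `s` can
be moved up to that cover. So intervals are chains. -/
theorem comparable_of_mem_Icc {s x y e : V} (hx : s ≤ x) (hy : s ≤ y) (hxe : x ≤ e) (hye : y ≤ e) :
    x ≤ y ∨ y ≤ x := by
  induction s using WellFoundedGT.induction with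
  | ind s ih =>
    rcases hx.eq_or_lt with rfl | hx
    · exact Or.inl hy
    rcases hy.eq_or_lt with rfl | hy
    · exact Or.inr hx.le
    obtain ⟨h1, h2⟩ := branch_spec hx
    obtain ⟨h3, h4⟩ := branch_spec hy
    have := covBy_unique h1 h3 (h2.trans hxe) (h4.trans hye)
    exact ih _ h1.lt h2 (this ▸ h4)

/-! ### Greatest lower bounds of multisets -/

/-- `v` is the greatest lower bound of the elements of `M`. -/
def IsMeet (M : Multiset V) (v : V) : Prop :=
  (∀ x ∈ M, v ≤ x) ∧ ∀ w, (∀ x ∈ M, w ≤ x) → w ≤ v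

omit [IsPolyforest V] [Finite V] in
theorem IsMeet.unique {M : Multiset V} {v w : V} (h : IsMeet M v) (h' : IsMeet M w) : v = w :=
  le_antisymm (h'.2 _ h.1) (h.2 _ h'.1)

/-- The greatest lower bound of a multiset, with a junk value if there is none. -/
noncomputable def meet [Nonempty V] (M : Multiset V) : V := Classical.epsilon (IsMeet M)

omit [IsPolyforest V] [Finite V] in
theorem IsMeet.meet_eq [Nonempty V] {M : Multiset V} {v : V} (h : IsMeet M v) : meet M = v :=
  (Classical.epsilon_spec (p := IsMeet M) ⟨v, h⟩).unique h

/-- A lower bound of `M` is the greatest one iff no single cover of it separates it from `M`. -/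
theorem isMeet_iff_branch {M : Multiset V} {v : V} (hM : M ≠ 0) (hv : ∀ x ∈ M, v ≤ x) :
    IsMeet M v ↔ ∀ c, v ⋖ c → ∃ x ∈ M, branch v x ≠ c := by
  constructor
  · intro h c hc
    by_contra! hall
    exact hc.lt.not_ge (h.2 c fun x hx => (branch_eq_iff_of_covBy hc (hv x hx)).1 (hall x hx))
  · intro h
    refine ⟨hv, fun w hw => ?_⟩
    obtain ⟨i, hi⟩ := Multiset.exists_mem_of_ne_zero hM
    -- Unless `v` itself belongs to `M`, two members lie beyond different covers of `v`, which is
    -- the situation of `le_of_branch`.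
    rcases branch_eq_or_covBy (hv i hi) with ⟨-, rfl⟩ | ⟨h1, h2⟩
    · exact hw _ hi
    obtain ⟨j, hj, hne⟩ := h _ h1
    rcases branch_eq_or_covBy (hv j hj) with ⟨-, rfl⟩ | ⟨h3, h4⟩
    · exact hw _ hj
    exact IsPolyforest.le_of_branch h1 h3 hne.symm h2 h4 (hw _ hi) (hw _ hj)

/-- A maximal lower bound is the greatest one: if all members lay beyond one cover `c` of it, then
`c` would be a larger lower bound. -/
theorem exists_isMeet {M : Multiset V} (hM : M ≠ 0) {u : V} (hu : ∀ x ∈ M, u ≤ x) :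
    ∃ v, IsMeet M v := by
  obtain ⟨v, hv⟩ := (Set.toFinite {v | ∀ x ∈ M, v ≤ x}).exists_maximal ⟨u, hu⟩
  refine ⟨v, (isMeet_iff_branch hM hv.1).2 fun c hc => ?_⟩
  by_contra! hall
  exact hc.lt.not_ge (hv.2
    (fun x hx => (branch_eq_iff_of_covBy hc (hv.1 x hx)).1 (hall x hx)) hc.le)

/-- Exchanging ends that agree strictly beyond the meet does not change the meet. -/
theorem IsMeet.exchange_of_lt {C : Multiset V} {s w i j : V} (h : IsMeet (i ::ₘ C) s) (hs : s < w)
    (hi : w ≤ i) (hj : w ≤ j) : IsMeet (j ::ₘ C) s := by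
  have hb : branch s i = branch s j := by rw [branch_eq_of_lt hs hi, branch_eq_of_lt hs hj]
  have hlb : ∀ x ∈ j ::ₘ C, s ≤ x := by
    intro x hx
    rcases Multiset.mem_cons.1 hx with rfl | hx
    · exact hs.le.trans hj
    · exact h.1 _ (Multiset.mem_cons_of_mem hx)
  rw [isMeet_iff_branch (by simp) hlb]
  intro c hc
  obtain ⟨x, hx, hne⟩ := (isMeet_iff_branch (by simp) h.1).1 h c hc
  rcases Multiset.mem_cons.1 hx with rfl | hx
  · exact ⟨j, by simp, hb ▸ hne⟩
  · exact ⟨x, Multiset.mem_cons_of_mem hx, hne⟩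

end Order

/-! ### Edge sets of directed paths -/

section Paths

variable {V : Type*} [PartialOrder V] [IsPolyforest V] [Fintype V]

open Classical in
/-- The covering pairs between `s` and `i`: the edges of the directed path from `s` to `i`. -/
noncomputable def pathEdges (s i : V) : Finset (V × V) :=
  Finset.univ.filter fun e => e.1 ⋖ e.2 ∧ s ≤ e.1 ∧ e.2 ≤ i

omit [IsPolyforest V] in
theorem mem_pathEdges {s i : V} {e : V × V} :
    e ∈ pathEdges s i ↔ e.1 ⋖ e.2 ∧ s ≤ e.1 ∧ e.2 ≤ i := by
  classical
  simp [pathEdges]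

omit [IsPolyforest V] in
theorem pathEdges_self (s : V) : pathEdges s s = ∅ := by
  ext e
  simp only [mem_pathEdges, Finset.notMem_empty, iff_false]
  rintro ⟨h1, h2, h3⟩
  exact h1.lt.not_ge (h3.trans h2)

omit [IsPolyforest V] in
theorem disjoint_pathEdges (s g i : V) : Disjoint (pathEdges s g) (pathEdges g i) := by
  rw [Finset.disjoint_left]
  intro e h h'
  rw [mem_pathEdges] at h h'
  exact h.1.lt.not_ge (h.2.2.trans h'.2.1)

open Classical in
theorem pathEdges_eq_union {s g i : V} (hs : s ≤ g) (hi : g ≤ i) :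
    pathEdges s i = pathEdges s g ∪ pathEdges g i := by
  ext ⟨u, c⟩
  simp only [mem_pathEdges, Finset.mem_union]
  constructor
  · rintro ⟨h1, h2, h3⟩
    rcases comparable_of_mem_Icc h2 hs (h1.le.trans h3) hi with h | h
    · rcases h.eq_or_lt with rfl | h
      · exact Or.inr ⟨h1, le_rfl, h3⟩
      · obtain ⟨h4, h5⟩ := branch_spec h
        have := covBy_unique h1 h4 h3 (h5.trans hi)
        exact Or.inl ⟨h1, h2, this ▸ h5⟩
    · exact Or.inr ⟨h1, h, h3⟩
  · rintro (⟨h1, h2, h3⟩ | ⟨h1, h2, h3⟩)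
    · exact ⟨h1, h2, h3.trans hi⟩
    · exact ⟨h1, hs.trans h2, h3⟩

theorem sum_pathEdges {A : Type*} [AddCommMonoid A] (f : V × V → A) {s g i : V} (hs : s ≤ g)
    (hi : g ≤ i) :
    ∑ e ∈ pathEdges s i, f e = ∑ e ∈ pathEdges s g, f e + ∑ e ∈ pathEdges g i, f e := by
  classical
  rw [pathEdges_eq_union hs hi, Finset.sum_union (disjoint_pathEdges s g i)]

/-- Exchanging the ends of two paths that share both ends as possible targets does not change the
edges used. -/
theorem sum_pathEdges_exchange {A : Type*} [AddCommMonoid A] (f : V × V → A) {s t i j : V}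
    (hsi : s ≤ i) (hsj : s ≤ j) (hti : t ≤ i) (htj : t ≤ j) :
    ∑ e ∈ pathEdges s i, f e + ∑ e ∈ pathEdges t j, f e =
      ∑ e ∈ pathEdges s j, f e + ∑ e ∈ pathEdges t i, f e := by
  -- Both `s` and `t` are lower bounds of `i` and `j`, so all four paths run through the meet `g`
  -- and can be cut there.
  obtain ⟨g, hg⟩ := exists_isMeet (M := {i, j}) (by simp) (u := s) (by simp [hsi, hsj])
  have hgi : g ≤ i := hg.1 _ (by simp)
  have hgj : g ≤ j := hg.1 _ (by simp)
  have hsg : s ≤ g := hg.2 _ (by simp [hsi, hsj])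
  have htg : t ≤ g := hg.2 _ (by simp [hti, htj])
  rw [sum_pathEdges f hsg hgi, sum_pathEdges f htg hgj, sum_pathEdges f hsg hgj,
    sum_pathEdges f htg hgi]
  abel

end Paths

end ThirdMoment

namespace ThirdMoment

/-! ### Boxes, exchanges and exponent vectors -/

section Weights

variable {V : Type*} [PartialOrder V]

/-- Exchange of two ends between two boxes of a multiset of boxes, leaving all meets unchanged. -/
def Exchange (U U' : Multiset (Multiset V)) : Prop :=
  ∃ (i j : V) (C D : Multiset V) (R : Multiset (Multiset V)) (s t : V),
    U = (i ::ₘ C) ::ₘ (j ::ₘ D) ::ₘ R ∧ U' = (j ::ₘ C) ::ₘ (i ::ₘ D) ::ₘ R ∧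
    IsMeet (i ::ₘ C) s ∧ IsMeet (j ::ₘ C) s ∧ IsMeet (j ::ₘ D) t ∧ IsMeet (i ::ₘ D) t

theorem Exchange.symm {U U' : Multiset (Multiset V)} (h : Exchange U U') : Exchange U' U := by
  obtain ⟨i, j, C, D, R, s, t, h1, h2, h3, h4, h5, h6⟩ := h
  exact ⟨j, i, C, D, R, s, t, h2, h1, h4, h3, h6, h5⟩

theorem Exchange.cons {U U' : Multiset (Multiset V)} (M : Multiset V) (h : Exchange U U') :
    Exchange (M ::ₘ U) (M ::ₘ U') := by
  obtain ⟨i, j, C, D, R, s, t, h1, h2, h⟩ := h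
  refine ⟨i, j, C, D, M ::ₘ R, s, t, ?_, ?_, h⟩
  · rw [h1, Multiset.cons_swap M, Multiset.cons_swap M]
  · rw [h2, Multiset.cons_swap M, Multiset.cons_swap M]

/-- Connected by exchanges. -/
abbrev Exchanges : Multiset (Multiset V) → Multiset (Multiset V) → Prop :=
  Relation.ReflTransGen Exchange

theorem Exchanges.symm {U U' : Multiset (Multiset V)} (h : Exchanges U U') : Exchanges U' U := by
  induction h with
  | refl => exact .refl
  | tail _ h ih => exact .head h.symm ih

theorem Exchanges.cons {U U' : Multiset (Multiset V)} (M : Multiset V) (h : Exchanges U U') :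
    Exchanges (M ::ₘ U) (M ::ₘ U') := by
  induction h with
  | refl => exact .refl
  | tail _ h ih => exact .tail ih (h.cons M)

/-- All boxes have two or three elements and a greatest lower bound. -/
def IsAdmissible (U : Multiset (Multiset V)) : Prop :=
  ∀ M ∈ U, (M.card = 2 ∨ M.card = 3) ∧ ∃ v, IsMeet M v

theorem IsAdmissible.of_cons {M : Multiset V} {U : Multiset (Multiset V)}
    (h : IsAdmissible (M ::ₘ U)) : IsAdmissible U :=
  fun N hN => h N (Multiset.mem_cons_of_mem hN)

theorem Exchange.isAdmissible {U U' : Multiset (Multiset V)} (h : Exchange U U')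
    (hU : IsAdmissible U) : IsAdmissible U' := by
  obtain ⟨i, j, C, D, R, s, t, rfl, rfl, h3, h4, h5, h6⟩ := h
  intro M hM
  rcases Multiset.mem_cons.1 hM with rfl | hM
  · exact ⟨by simpa using (hU (i ::ₘ C) (by simp)).1, s, h4⟩
  rcases Multiset.mem_cons.1 hM with rfl | hM
  · exact ⟨by simpa using (hU (j ::ₘ D) (by simp)).1, t, h6⟩
  · exact hU M (by simp [hM])

theorem Exchanges.isAdmissible {U U' : Multiset (Multiset V)} (h : Exchanges U U')
    (hU : IsAdmissible U) : IsAdmissible U' := by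
  induction h with
  | refl => exact hU
  | tail _ h ih => exact h.isAdmissible ih

variable [Fintype V] [Nonempty V]

/-- The exponent vector of a box: its cardinality and meet, and the edges of the paths from its
meet to its elements. -/
noncomputable def boxWeight (M : Multiset V) : ((ℕ × V) ⊕ (V × V)) →₀ ℕ :=
  Finsupp.single (Sum.inl (M.card, meet M)) 1 +
    (M.map fun i => ∑ e ∈ pathEdges (meet M) i, Finsupp.single (Sum.inr e) 1).sum

/-- The sum of the exponent vectors of the boxes. -/
noncomputable def weight (U : Multiset (Multiset V)) : ((ℕ × V) ⊕ (V × V)) →₀ ℕ :=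
  (U.map boxWeight).sum

theorem weight_cons (M : Multiset V) (U : Multiset (Multiset V)) :
    weight (M ::ₘ U) = boxWeight M + weight U := by
  simp [weight]

theorem weight_apply (U : Multiset (Multiset V)) (x : (ℕ × V) ⊕ (V × V)) :
    weight U x = (U.map fun M => boxWeight M x).sum := by
  induction U using Multiset.induction_on with
  | empty => simp [weight]
  | cons M U ih => simp [weight_cons, ih]

/-- The meets, and with them the `Sum.inl` parts, are kept; only the paths to `i` and `j` trade
ends, which `sum_pathEdges_exchange` covers. This is why 2-minors of trek-matrices lie in the
kernel. -/
theorem boxWeight_exchange [IsPolyforest V] {i j s t : V} {C D : Multiset V}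
    (h3 : IsMeet (i ::ₘ C) s) (h4 : IsMeet (j ::ₘ C) s) (h5 : IsMeet (j ::ₘ D) t)
    (h6 : IsMeet (i ::ₘ D) t) :
    boxWeight (i ::ₘ C) + boxWeight (j ::ₘ D) = boxWeight (j ::ₘ C) + boxWeight (i ::ₘ D) := by
  simp only [boxWeight, h3.meet_eq, h4.meet_eq, h5.meet_eq, h6.meet_eq, Multiset.card_cons,
    Multiset.map_cons, Multiset.sum_cons]
  have := sum_pathEdges_exchange (s := s) (t := t) (i := i) (j := j)
    (fun e => (Finsupp.single (Sum.inr e) 1 : ((ℕ × V) ⊕ (V × V)) →₀ ℕ))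
    (h3.1 _ (by simp)) (h4.1 _ (by simp)) (h6.1 _ (by simp)) (h5.1 _ (by simp))
  set a := (C.map fun i => ∑ e ∈ pathEdges s i,
    (Finsupp.single (Sum.inr e) 1 : ((ℕ × V) ⊕ (V × V)) →₀ ℕ)).sum
  set b := (D.map fun i => ∑ e ∈ pathEdges t i,
    (Finsupp.single (Sum.inr e) 1 : ((ℕ × V) ⊕ (V × V)) →₀ ℕ)).sum
  have hrw : ∀ {x y p q p' q' a b : ((ℕ × V) ⊕ (V × V)) →₀ ℕ}, p + q = p' + q' →
      x + (p + a) + (y + (q + b)) = x + (p' + a) + (y + (q' + b)) := by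
    intro x y p q p' q' a b h
    calc _ = (p + q) + (x + a + y + b) := by abel
      _ = _ := by rw [h]; abel
  exact hrw this

theorem Exchange.weight_eq [IsPolyforest V] {U U' : Multiset (Multiset V)} (h : Exchange U U') :
    weight U = weight U' := by
  obtain ⟨i, j, C, D, R, s, t, rfl, rfl, h3, h4, h5, h6⟩ := h
  simp only [weight_cons, ← add_assoc, boxWeight_exchange h3 h4 h5 h6]

theorem Exchanges.weight_eq [IsPolyforest V] {U U' : Multiset (Multiset V)} (h : Exchanges U U') :
    weight U = weight U' := by
  induction h with
  | refl => rfl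
  | tail _ h ih => exact ih.trans h.weight_eq

/-! ### Counting branches -/

open Classical in
/-- The number of paths from `s` to elements of `C` that pass through `w` and continue to `c`, or
end at `w` if `c = w`. -/
noncomputable def branchCount (w c s : V) (C : Multiset V) : ℕ :=
  if s ≤ w then C.countP (fun i => w ≤ i ∧ branch w i = c) else 0

/-- The number of paths in all boxes that pass through `w` and continue to `c`, or end at `w` if
`c = w`. -/
noncomputable def totalBranchCount (w c : V) (U : Multiset (Multiset V)) : ℕ :=
  (U.map fun M => branchCount w c (meet M) M).sum

omit [Fintype V] [Nonempty V] in
theorem branchCount_add (w c s : V) (C D : Multiset V) :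
    branchCount w c s (C + D) = branchCount w c s C + branchCount w c s D := by
  unfold branchCount
  split_ifs <;> simp

omit [Fintype V] [Nonempty V] in
theorem branchCount_cons_of_eq {w s i : V} (C : Multiset V) (hs : s ≤ w) (hi : w ≤ i) :
    branchCount w (branch w i) s (i ::ₘ C) = branchCount w (branch w i) s C + 1 := by
  classical
  simp [branchCount, hs, hi]

omit [Fintype V] [Nonempty V] in
theorem branchCount_pos {w c s : V} {C : Multiset V} (h : 0 < branchCount w c s C) :
    s ≤ w ∧ ∃ i ∈ C, w ≤ i ∧ branch w i = c := by
  classical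
  unfold branchCount at h
  split_ifs at h with hs
  · exact ⟨hs, Multiset.countP_pos.1 h⟩
  · simp at h

omit [Fintype V] [Nonempty V] in
open Classical in
theorem branchCount_eq_count {v c : V} {C : Multiset V} (h : ∀ x ∈ C, v ≤ x) :
    branchCount v c v C = (C.map (branch v)).count c := by
  simp only [branchCount, le_rfl, if_true, Multiset.count_map, ← Multiset.countP_eq_card_filter]
  refine Multiset.countP_congr rfl fun x hx => ?_
  simp [h x hx, eq_comm]

omit [Fintype V] in
theorem totalBranchCount_cons (w c : V) (M : Multiset V) (U : Multiset (Multiset V)) :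
    totalBranchCount w c (M ::ₘ U) = branchCount w c (meet M) M + totalBranchCount w c U := by
  simp [totalBranchCount]

omit [Fintype V] in
theorem totalBranchCount_pos {w c : V} {U : Multiset (Multiset V)}
    (h : 0 < totalBranchCount w c U) : ∃ N ∈ U, 0 < branchCount w c (meet N) N := by
  by_contra! hall
  refine h.ne' (Multiset.sum_eq_zero fun x hx => ?_)
  obtain ⟨N, hN, rfl⟩ := Multiset.mem_map.1 hx
  exact Nat.le_zero.1 (hall N hN)

open Classical in
theorem boxWeight_inr (M : Multiset V) (e : V × V) :
    boxWeight M (Sum.inr e) = M.countP (fun i => e ∈ pathEdges (meet M) i) := by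
  rw [boxWeight, Finsupp.add_apply, Finsupp.single_eq_of_ne (by simp), zero_add]
  generalize meet M = s
  induction M using Multiset.induction_on with
  | empty => simp
  | cons i M ih =>
    rw [Multiset.map_cons, Multiset.sum_cons, Finsupp.add_apply, ih, Multiset.countP_cons,
      add_comm, Finsupp.finsetSum_apply]
    congr 1
    simp [Finsupp.single_apply, Finset.sum_ite_eq']

open Classical in
theorem boxWeight_inl (M : Multiset V) (k : ℕ) (v : V) :
    boxWeight M (Sum.inl (k, v)) = if M.card = k ∧ meet M = v then 1 else 0 := by
  rw [boxWeight, Finsupp.add_apply]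
  have : ((M.map fun i => ∑ e ∈ pathEdges (meet M) i,
      (Finsupp.single (Sum.inr e) 1 : ((ℕ × V) ⊕ (V × V)) →₀ ℕ)).sum) (Sum.inl (k, v)) = 0 := by
    generalize meet M = s
    induction M using Multiset.induction_on with
    | empty => simp
    | cons i M ih => simp [ih]
  rw [this, Finsupp.single_apply]
  simp

variable [IsPolyforest V]

theorem boxWeight_inr_eq_branchCount {w c : V} (h : w ⋖ c) (M : Multiset V) :
    boxWeight M (Sum.inr (w, c)) = branchCount w c (meet M) M := by
  classical
  rw [boxWeight_inr, branchCount]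
  split_ifs with hs
  · refine Multiset.countP_congr rfl fun i _ => ?_
    simp only [mem_pathEdges, h, hs, true_and]
    exact propext ⟨fun hc => ⟨h.le.trans hc, branch_eq_of_covBy h hc⟩,
      fun hc => (branch_eq_iff_of_covBy h hc.1).1 hc.2⟩
  · rw [Multiset.countP_eq_zero]
    simp [mem_pathEdges, hs]

omit [Nonempty V] in
open Classical in
/-- The number of edges entering `w` on the path from `s` to `i`. -/
theorem sum_mem_pathEdges_right (s w i : V) :
    ∑ u, (if (u, w) ∈ pathEdges s i then 1 else 0) = if s < w ∧ w ≤ i then 1 else 0 := by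
  split_ifs with h
  · obtain ⟨u, hu, huw⟩ := exists_le_covBy_of_lt h.1
    rw [Finset.sum_eq_single u]
    · rw [if_pos (mem_pathEdges.2 ⟨huw, hu, h.2⟩)]
    · intro x _ hx
      rw [if_neg]
      intro hm
      obtain ⟨h1, h2, -⟩ := mem_pathEdges.1 hm
      rcases comparable_of_mem_Icc h2 hu h1.le huw.le with h' | h'
      · rcases h'.eq_or_lt with h' | h'
        · exact hx h'
        · exact h1.2 h' huw.lt
      · rcases h'.eq_or_lt with h' | h'
        · exact hx h'.symm
        · exact huw.2 h' h1.lt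
    · simp
  · refine Finset.sum_eq_zero fun u _ => if_neg fun hm => h ?_
    obtain ⟨h1, h2, h3⟩ := mem_pathEdges.1 hm
    exact ⟨h2.trans_lt h1.lt, h3⟩

omit [Nonempty V] in
open Classical in
/-- The number of edges leaving `w` on the path from `s` to `i`. -/
theorem sum_mem_pathEdges_left (s w i : V) :
    ∑ c, (if (w, c) ∈ pathEdges s i then 1 else 0) = if s ≤ w ∧ w < i then 1 else 0 := by
  split_ifs with h
  · obtain ⟨hb, hbi⟩ := branch_spec h.2
    rw [Finset.sum_eq_single (branch w i)]
    · rw [if_pos (mem_pathEdges.2 ⟨hb, h.1, hbi⟩)]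
    · intro x _ hx
      rw [if_neg]
      intro hm
      obtain ⟨h1, -, h3⟩ := mem_pathEdges.1 hm
      exact hx (branch_eq_of_covBy h1 h3).symm
    · simp
  · refine Finset.sum_eq_zero fun u _ => if_neg fun hm => h ?_
    obtain ⟨h1, h2, h3⟩ := mem_pathEdges.1 hm
    exact ⟨h2, h1.lt.trans_le h3⟩

open Classical in
/-- Conservation of flow at `w` for the paths of a box. -/
theorem count_add_sum_boxWeight {M : Multiset V} (hM : (M.card = 2 ∨ M.card = 3) ∧ ∃ v, IsMeet M v)
    (w : V) :
    branchCount w w (meet M) M + ∑ c, boxWeight M (Sum.inr (w, c)) =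
      2 * boxWeight M (Sum.inl (2, w)) + 3 * boxWeight M (Sum.inl (3, w)) +
        ∑ u, boxWeight M (Sum.inr (u, w)) := by
  obtain ⟨hcard, v, hv⟩ := hM
  -- For every path, ending at `w` or leaving it balances starting at `w` or entering it. A box of
  -- size `k` starts `k` paths at its meet, hence the factors 2 and 3.
  have hflow : ∀ (s : V) (C : Multiset V), (∀ x ∈ C, s ≤ x) →
      branchCount w w s C + ∑ c, C.countP (fun i => (w, c) ∈ pathEdges s i) =
        (if s = w then C.card else 0) + ∑ u, C.countP (fun i => (u, w) ∈ pathEdges s i) := by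
    intro s C
    induction C using Multiset.induction_on with
    | empty => simp [branchCount]
    | cons i C ih =>
      intro hC
      have hsi : s ≤ i := hC i (by simp)
      have ih := ih fun x hx => hC x (by simp [hx])
      have hb : branchCount w w s (i ::ₘ C) = branchCount w w s C + if i = w then 1 else 0 := by
        rw [← Multiset.singleton_add, branchCount_add, add_comm]
        congr 1
        unfold branchCount
        by_cases hi : i = w
        · subst hi
          rw [if_pos hsi, if_pos rfl, Multiset.countP_eq_card.2] <;> simp [branch_self]
        · rw [if_neg hi]
          split_ifs
          · rw [Multiset.countP_eq_zero]
            intro x hx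
            rw [Multiset.mem_singleton.1 hx]
            rintro ⟨h1, h2⟩
            exact hi ((branch_eq_self_iff h1).1 h2)
          · rfl
      simp only [Multiset.countP_cons, Finset.sum_add_distrib, hb, Multiset.card_cons,
        sum_mem_pathEdges_left, sum_mem_pathEdges_right]
      have key : (if i = w then 1 else 0) + (if s ≤ w ∧ w < i then 1 else 0) =
          (if s = w then 1 else 0) + if s < w ∧ w ≤ i then 1 else 0 := by
        by_cases h1 : s ≤ w ∧ w ≤ i
        · obtain ⟨h1, h2⟩ := h1
          rcases h1.eq_or_lt with rfl | h1 <;> rcases h2.eq_or_lt with rfl | h2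
          · simp
          · simp [h2, h2.ne']
          · simp [h1, h1.ne, h1.le]
          · simp [h1, h1.ne, h1.le, h2, h2.le, h2.ne']
        · have a1 : i ≠ w := by rintro rfl; exact h1 ⟨hsi, le_rfl⟩
          have a2 : s ≠ w := by rintro rfl; exact h1 ⟨le_rfl, hsi⟩
          have a3 : ¬ (s ≤ w ∧ w < i) := fun h => h1 ⟨h.1, h.2.le⟩
          have a4 : ¬ (s < w ∧ w ≤ i) := fun h => h1 ⟨h.1.le, h.2⟩
          simp only [if_neg a1, if_neg a2, if_neg a3, if_neg a4]
      split_ifs at ih key ⊢ <;> omega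
  simp only [boxWeight_inr, boxWeight_inl]
  rw [hflow (meet M) M (by rw [hv.meet_eq]; exact hv.1)]
  congr 1
  rcases hcard with h | h <;> simp [h]

/-- The weight determines all branch counts. -/
theorem totalBranchCount_eq_of_weight_eq {U W : Multiset (Multiset V)} (hU : IsAdmissible U)
    (hW : IsAdmissible W) (h : weight U = weight W) (w c : V) :
    totalBranchCount w c U = totalBranchCount w c W := by
  by_cases hc : w ⋖ c
  · have : ∀ U : Multiset (Multiset V), totalBranchCount w c U = weight U (Sum.inr (w, c)) := by
      intro U
      rw [weight_apply, totalBranchCount]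
      simp only [boxWeight_inr_eq_branchCount hc]
    rw [this, this, h]
  -- Paths that end at `w` have no exponent of their own; flow conservation recovers their number
  -- from the exponents.
  by_cases hcw : c = w
  · subst hcw
    have : ∀ U : Multiset (Multiset V), IsAdmissible U →
        totalBranchCount c c U + ∑ d, weight U (Sum.inr (c, d)) =
        2 * weight U (Sum.inl (2, c)) + 3 * weight U (Sum.inl (3, c)) +
        ∑ u, weight U (Sum.inr (u, c)) := by
      intro U
      induction U using Multiset.induction_on with
      | empty => simp [weight, totalBranchCount]
      | cons M U ih =>
        intro hU
        have h1 := ih hU.of_cons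
        have h2 := count_add_sum_boxWeight (hU M (by simp)) c
        simp only [weight_cons, Finsupp.add_apply, totalBranchCount_cons, Finset.sum_add_distrib]
        omega
    have h1 := this U hU
    have h2 := this W hW
    rw [h] at h1
    omega
  · have : ∀ U : Multiset (Multiset V), totalBranchCount w c U = 0 := by
      intro U
      by_contra hne
      obtain ⟨N, -, hN⟩ := totalBranchCount_pos (Nat.pos_of_ne_zero hne)
      obtain ⟨-, i, -, hi, hb⟩ := branchCount_pos hN
      rcases branch_eq_or_covBy hi with h | h
      · exact hcw (hb.symm.trans h.1)
      · exact hc (hb ▸ h.1)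
    rw [this, this]

omit [IsPolyforest V] in
/-- The weight determines the cardinalities and meets of the boxes. -/
theorem exists_mem_of_weight_eq {U W : Multiset (Multiset V)} (h : weight U = weight W)
    {M : Multiset V} (hM : M ∈ U) : ∃ N ∈ W, N.card = M.card ∧ meet N = meet M := by
  classical
  by_contra! hall
  have h0 : weight W (Sum.inl (M.card, meet M)) = 0 := by
    rw [weight_apply]
    refine Multiset.sum_eq_zero fun x hx => ?_
    obtain ⟨N, hN, rfl⟩ := Multiset.mem_map.1 hx
    rw [boxWeight_inl, if_neg]
    exact fun h => hall N hN h.1 h.2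
  obtain ⟨R, rfl⟩ := Multiset.exists_cons_of_mem hM
  rw [← h, weight_cons, Finsupp.add_apply, boxWeight_inl] at h0
  simp at h0

end Weights

end ThirdMoment

namespace ThirdMoment

/-! ### Boxes with equal weight are connected by exchanges -/

section Connectivity

variable {V : Type*} [PartialOrder V] [IsPolyforest V] [Fintype V] [Nonempty V]

omit [IsPolyforest V] [Fintype V] [Nonempty V] in
theorem IsAdmissible.isMeet_meet [Nonempty V] {U : Multiset (Multiset V)} (hU : IsAdmissible U)
    {M : Multiset V} (hM : M ∈ U) : IsMeet M (meet M) := by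
  obtain ⟨v, hv⟩ := (hU M hM).2
  rwa [hv.meet_eq]

/-- If the branch `d` at `v` is more frequent than the branch `s`, then some path on the branch `d`
can be rerouted along the branch `s` without changing the meet of its box. -/
theorem exists_reroutable {v s d : V} {R : Multiset (Multiset V)} (hR : IsAdmissible R)
    (hsd : s ≠ d)
    (h : totalBranchCount v s R < totalBranchCount v d R ∨ (s = v ∧ 0 < totalBranchCount v d R)) :
    ∃ j D R₀, R = (j ::ₘ D) ::ₘ R₀ ∧ v ≤ j ∧ branch v j = d ∧
      ∀ i, v ≤ i → branch v i = s → IsMeet (i ::ₘ D) (meet (j ::ₘ D)) := by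
  classical
  by_contra! hall
  -- If a path on the branch `d` cannot be rerouted, then its box has meet exactly `v` and all its
  -- other elements lie on the branch `s`, so that rerouting would push the meet up to `s`.
  have key : ∀ j D R₀, R = (j ::ₘ D) ::ₘ R₀ → meet (j ::ₘ D) ≤ v → v ≤ j → branch v j = d →
      meet (j ::ₘ D) = v ∧ v ⋖ s ∧ ∀ x ∈ D, branch v x = s := by
    intro j D R₀ hRe hm hj hb
    obtain ⟨i, hi, hbi, hno⟩ := hall j D R₀ hRe hj hb
    have hmeet := hR.isMeet_meet (M := j ::ₘ D) (by simp [hRe])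
    rcases hm.lt_or_eq with hm | hm
    · exact absurd (hmeet.exchange_of_lt hm hj hi) hno
    rw [hm] at hno hmeet
    have hlb : ∀ x ∈ i ::ₘ D, v ≤ x := by
      intro x hx
      rcases Multiset.mem_cons.1 hx with rfl | hx
      · exact hi
      · exact hmeet.1 _ (Multiset.mem_cons_of_mem hx)
    rw [isMeet_iff_branch (by simp) hlb] at hno
    push Not at hno
    obtain ⟨c, hc, hall'⟩ := hno
    have hcs : c = s := by rw [← hbi, hall' i (by simp)]
    subst hcs
    exact ⟨hm, hc, fun x hx => hall' x (by simp [hx])⟩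
  -- Each such box has one path on `d` and, having at least two elements, at least one on `s`. Hence
  -- no box has more paths on `d` than on `s`, and the case `s = v` is impossible since `s` covers
  -- `v`.
  have hle : ∀ N ∈ R, branchCount v d (meet N) N ≤ branchCount v s (meet N) N ∧
      (s = v → branchCount v d (meet N) N = 0) := by
    intro N hN
    rcases Nat.eq_zero_or_pos (branchCount v d (meet N) N) with h0 | h0
    · simp [h0]
    obtain ⟨hm, j, hj, hvj, hb⟩ := branchCount_pos h0
    obtain ⟨D, rfl⟩ := Multiset.exists_cons_of_mem hj
    obtain ⟨R₀, rfl⟩ := Multiset.exists_cons_of_mem hN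
    obtain ⟨hm', hvs, hD⟩ := key j D R₀ rfl hm hvj hb
    refine ⟨?_, fun hs => absurd hvs.lt (by simp [hs])⟩
    have hmeet := hR.isMeet_meet (M := j ::ₘ D) (by simp)
    rw [hm'] at hmeet ⊢
    have hrep : D.map (branch v) = Multiset.replicate D.card s := by
      rw [Multiset.eq_replicate]
      simpa using hD
    have hcard : 1 ≤ D.card := by
      have := (hR (j ::ₘ D) (by simp)).1
      simp only [Multiset.card_cons] at this
      omega
    rw [branchCount_eq_count hmeet.1, branchCount_eq_count hmeet.1, Multiset.map_cons, hb, hrep,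
      Multiset.count_cons_self, Multiset.count_cons_of_ne hsd, Multiset.count_replicate_self,
      Multiset.count_replicate, if_neg hsd]
    omega
  rcases h with h | ⟨hs, h⟩
  · exact absurd (Multiset.sum_map_le_sum_map _ _ fun N hN => (hle N hN).1) (not_le.2 h)
  · obtain ⟨N, hN, hpos⟩ := totalBranchCount_pos h
    exact hpos.ne' ((hle N hN).2 hs)

omit [IsPolyforest V] [Nonempty V] in
/-- A most frequent branch among those that are not excluded, or the trivial branch `v` if there
is none. -/
theorem exists_greedy_branch (v : V) (n : V → ℕ) (ex : V → Prop) :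
    ∃ d, (v ⋖ d ∧ ¬ ex d ∧ 0 < n d ∧ ∀ s, v ⋖ s → ¬ ex s → n s ≤ n d) ∨
      (d = v ∧ ∀ s, v ⋖ s → ¬ ex s → n s = 0) := by
  by_cases h : ∃ s, v ⋖ s ∧ ¬ ex s ∧ 0 < n s
  · obtain ⟨d, hd, hmax⟩ := Set.exists_max_image {s | v ⋖ s ∧ ¬ ex s ∧ 0 < n s} n
      (Set.toFinite _) h
    refine ⟨d, Or.inl ⟨hd.1, hd.2.1, hd.2.2, fun s h1 h2 => ?_⟩⟩
    rcases Nat.eq_zero_or_pos (n s) with h0 | h0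
    · simp [h0]
    · exact hmax s ⟨h1, h2, h0⟩
  · push Not at h
    exact ⟨v, Or.inr ⟨rfl, fun s h1 h2 => Nat.le_zero.1 (h s h1 h2)⟩⟩

open Classical in
/-- A box with meet `v` can be made to contain an end on a greedily chosen branch `d`, while its
part `K` is kept. -/
theorem exists_exchanges_branch_mem {v d : V} {n : V → ℕ} {ex : V → Prop}
    (hd : (v ⋖ d ∧ ¬ ex d ∧ 0 < n d ∧ ∀ s, v ⋖ s → ¬ ex s → n s ≤ n d) ∨
      (d = v ∧ ∀ s, v ⋖ s → ¬ ex s → n s = 0))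
    {K C : Multiset V} {R : Multiset (Multiset V)} (hU : IsAdmissible ((K + C) ::ₘ R))
    (hm : IsMeet (K + C) v)
    (hn : ∀ c, totalBranchCount v c ((K + C) ::ₘ R) = (K.map (branch v)).count c + n c)
    (hex : ∃ i ∈ C, ¬ ex (branch v i))
    (hnew : ∀ i j C', C = i ::ₘ C' → v ≤ j → branch v j = d → (∀ x ∈ C', branch v x ≠ d) →
      IsMeet (K + j ::ₘ C') v) :
    ∃ j C' R', Exchanges ((K + C) ::ₘ R) ((K + j ::ₘ C') ::ₘ R') ∧ IsMeet (K + j ::ₘ C') v ∧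
      branch v j = d ∧ C'.card + 1 = C.card := by
  by_cases hmem : ∃ j ∈ C, branch v j = d
  · obtain ⟨j, hj, hb⟩ := hmem
    obtain ⟨C', rfl⟩ := Multiset.exists_cons_of_mem hj
    exact ⟨j, C', R, .refl, hm, hb, by simp⟩
  push Not at hmem
  obtain ⟨i, hi, hexi⟩ := hex
  obtain ⟨C', rfl⟩ := Multiset.exists_cons_of_mem hi
  have hlb := hm.1
  have hvi : v ≤ i := hlb i (by simp)
  have htot : ∀ c, ((i ::ₘ C').map (branch v)).count c + totalBranchCount v c R = n c := by
    intro c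
    have := hn c
    rw [totalBranchCount_cons, hm.meet_eq, branchCount_eq_count hlb, Multiset.map_add,
      Multiset.count_add] at this
    omega
  have hd0 : ((i ::ₘ C').map (branch v)).count d = 0 := by
    rw [Multiset.count_eq_zero]
    simp only [Multiset.mem_map, not_exists, not_and]
    exact hmem
  have hs1 : 1 ≤ ((i ::ₘ C').map (branch v)).count (branch v i) := by
    rw [Multiset.one_le_count_iff_mem]
    simp
  have hne : branch v i ≠ d := hmem i (by simp)
  -- `C` uses the branch of `i` but not `d`. As `d` is greedy, the remaining boxes must contain more
  -- paths on `d` than on the branch of `i`; if `i = v`, it is enough that they contain one on `d`.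
  have hcount : totalBranchCount v (branch v i) R < totalBranchCount v d R ∨
      (branch v i = v ∧ 0 < totalBranchCount v d R) := by
    have h1 := htot d
    have h2 := htot (branch v i)
    rcases branch_eq_or_covBy hvi with ⟨hb, -⟩ | ⟨hb, -⟩
    · right
      rcases hd with hd | hd
      · exact ⟨hb, by omega⟩
      · exact absurd (hb.trans hd.1.symm) hne
    · left
      rcases hd with hd | hd
      · have := hd.2.2.2 _ hb hexi
        omega
      · have := hd.2 _ hb hexi
        omega
  obtain ⟨j, D, R₀, rfl, hvj, hbj, hre⟩ := exists_reroutable hU.of_cons hne hcount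
  have hnew' : IsMeet (K + j ::ₘ C') v :=
    hnew i j C' rfl hvj hbj fun x hx => hmem x (by simp [hx])
  refine ⟨j, C', (i ::ₘ D) ::ₘ R₀, .single ?_, hnew', hbj, by simp⟩
  refine ⟨i, j, K + C', D, R₀, v, meet (j ::ₘ D), ?_, ?_, ?_, ?_, ?_, hre i hvi rfl⟩
  · rw [Multiset.add_cons]
  · rw [Multiset.add_cons]
  · rwa [Multiset.add_cons] at hm
  · rwa [Multiset.add_cons] at hnew'
  · exact hU.of_cons.isMeet_meet (by simp)

omit [Nonempty V] in
theorem IsMeet.not_forall_branch {M : Multiset V} {v : V} (h : IsMeet M v) (hM : M ≠ 0) {c : V}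
    (hc : v ⋖ c) : ∃ x ∈ M, branch v x ≠ c :=
  (isMeet_iff_branch hM h.1).1 h c hc

open Classical in
/-- The branches of some box with meet `v` and given cardinality can be prescribed in terms of the
branch counts at `v` only. -/
theorem exists_normal_branches (v : V) (n : V → ℕ) (k : ℕ) :
    ∃ T : Multiset V, ∀ U : Multiset (Multiset V), IsAdmissible U →
      (∀ c, totalBranchCount v c U = n c) → ∀ M ∈ U, M.card = k → meet M = v →
      ∃ M' R', Exchanges U (M' ::ₘ R') ∧ IsMeet M' v ∧ M'.map (branch v) = T := by
  -- `c₂` must not repeat a cover `c₁`; then the first two branches alone force the meet to be `v`,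
  -- and `c₃` is unrestricted. Repeating the trivial branch `v` is harmless.
  obtain ⟨c₁, hc₁⟩ := exists_greedy_branch v n fun _ => False
  obtain ⟨c₂, hc₂⟩ := exists_greedy_branch v (fun c => n c - ({c₁} : Multiset V).count c)
    fun c => v ⋖ c ∧ c = c₁
  obtain ⟨c₃, hc₃⟩ := exists_greedy_branch v (fun c => n c - ({c₁, c₂} : Multiset V).count c)
    fun _ => False
  refine ⟨if k = 2 then {c₁, c₂} else {c₁, c₂, c₃}, fun U hU hn M hM hk hmeet => ?_⟩
  obtain ⟨R, rfl⟩ := Multiset.exists_cons_of_mem hM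
  have hMv : IsMeet M v := hmeet ▸ hU.isMeet_meet hM
  have hcard := (hU M hM).1
  have htot : ∀ U', Exchanges (M ::ₘ R) U' → ∀ c, totalBranchCount v c U' = n c := fun U' h c =>
    (totalBranchCount_eq_of_weight_eq (h.isAdmissible hU) hU h.weight_eq.symm v c).trans (hn c)
  have hnot : ∀ {c : V}, v ⋖ c → c ≠ v := fun h => h.lt.ne'
  obtain ⟨i₁, C₁, R₁, hex₁, hm₁, hb₁, hcd₁⟩ := exists_exchanges_branch_mem (K := 0) (C := M) (R := R)
    (d := c₁) (ex := fun _ => False) hc₁ (by simpa using hU) (by simpa using hMv) (by simpa using hn)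
    (by
      obtain ⟨i, hi⟩ := Multiset.card_pos_iff_exists_mem.1 (by omega : 0 < M.card)
      exact ⟨i, hi, by simp⟩)
    (by
      rintro i j C' rfl hvj hbj hC'
      rw [zero_add]
      have hlb : ∀ x ∈ j ::ₘ C', v ≤ x := by
        intro x hx
        rcases Multiset.mem_cons.1 hx with rfl | hx
        · exact hvj
        · exact hMv.1 _ (by simp [hx])
      rw [isMeet_iff_branch (by simp) hlb]
      intro c hc
      by_contra! hall
      obtain ⟨x, hx⟩ := Multiset.card_pos_iff_exists_mem.1
        (by simp only [Multiset.card_cons] at hcard; omega : 0 < C'.card)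
      exact hC' x hx ((hall x (by simp [hx])).trans ((hall j (by simp)).symm.trans hbj)))
  simp only [zero_add] at hex₁ hm₁
  have hK₁ : ∀ x ∈ i₁ ::ₘ C₁, v ≤ x := hm₁.1
  have hvi₁ : v ≤ i₁ := hK₁ _ (by simp)
  -- The chosen branch occurs in the box, so the subtraction `n c - count` is not truncated.
  have hcount₁ : ∀ c, ({c₁} : Multiset V).count c ≤ n c := by
    intro c
    rw [← htot _ hex₁ c, totalBranchCount_cons, hm₁.meet_eq, branchCount_eq_count hK₁,
      Multiset.map_cons, hb₁, ← Multiset.singleton_add, Multiset.count_add]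
    omega
  obtain ⟨i₂, C₂, R₂, hex₂, hm₂, hb₂, hcd₂⟩ := exists_exchanges_branch_mem (K := {i₁}) (C := C₁)
    (R := R₁) (d := c₂) (n := fun c => n c - ({c₁} : Multiset V).count c)
    (ex := fun c => v ⋖ c ∧ c = c₁) hc₂ (by simpa using hex₁.isAdmissible hU) (by simpa using hm₁)
    (by
      intro c
      rw [Multiset.singleton_add, htot _ hex₁ c, Multiset.map_singleton, hb₁]
      have := hcount₁ c
      omega)
    -- If all of `C₁` lay on the excluded cover `c₁`, the whole box would, and its meet would not be
    -- `v`.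
    (by
      by_contra! hall
      obtain ⟨x, hx⟩ := Multiset.card_pos_iff_exists_mem.1 (by omega : 0 < C₁.card)
      have hx1 := hall x hx
      have hv1 : v ⋖ c₁ := hx1.2 ▸ hx1.1
      obtain ⟨y, hy, hne⟩ := hm₁.not_forall_branch (by simp) hv1
      rcases Multiset.mem_cons.1 hy with rfl | hy
      · exact hne hb₁
      · exact hne (hall y hy).2)
    (by
      rintro i j C' rfl hvj hbj -
      rw [Multiset.singleton_add]
      have hlb : ∀ x ∈ i₁ ::ₘ j ::ₘ C', v ≤ x := by
        intro x hx
        rcases Multiset.mem_cons.1 hx with rfl | hx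
        · exact hvi₁
        rcases Multiset.mem_cons.1 hx with rfl | hx
        · exact hvj
        · exact hK₁ _ (by simp [hx])
      rw [isMeet_iff_branch (by simp) hlb]
      intro c hc
      by_contra! hall
      have h1 := hall i₁ (by simp)
      have h2 := hall j (by simp)
      rcases hc₂ with hc₂ | hc₂
      · exact hc₂.2.1 ⟨hc₂.1, by rw [← hbj, h2, ← h1, hb₁]⟩
      · exact hnot hc (by rw [← h2, hbj, hc₂.1]))
  simp only [Multiset.singleton_add] at hex₂ hm₂
  have hex₂ : Exchanges _ _ := hex₁.trans hex₂
  by_cases hk2 : k = 2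
  · have hC₂ : C₂ = 0 := by
      rw [← Multiset.card_eq_zero]
      omega
    subst hC₂
    exact ⟨_, R₂, hex₂, hm₂, by simp [hk2, hb₁, hb₂]⟩
  have hK₂ : ∀ x ∈ i₁ ::ₘ i₂ ::ₘ C₂, v ≤ x := hm₂.1
  have hcount₂ : ∀ c, ({c₁, c₂} : Multiset V).count c ≤ n c := by
    intro c
    rw [← htot _ hex₂ c, totalBranchCount_cons, hm₂.meet_eq, branchCount_eq_count hK₂,
      Multiset.map_cons, Multiset.map_cons, hb₁, hb₂, ← Multiset.singleton_add c₂,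
      ← Multiset.cons_add, Multiset.count_add]
    exact le_trans (Nat.le_add_right _ _) (Nat.le_add_right _ _)
  have hne12 : ∀ c, v ⋖ c → c₁ = c → c₂ = c → False := by
    rintro c hc rfl rfl
    rcases hc₂ with hc₂ | hc₂
    · exact hc₂.2.1 ⟨hc₂.1, rfl⟩
    · exact hnot hc hc₂.1
  obtain ⟨i₃, C₃, R₃, hex₃, hm₃, hb₃, hcd₃⟩ := exists_exchanges_branch_mem (K := {i₁, i₂}) (C := C₂)
    (R := R₂) (d := c₃) (n := fun c => n c - ({c₁, c₂} : Multiset V).count c)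
    (ex := fun _ => False) hc₃ (by simpa using hex₂.isAdmissible hU) (by simpa using hm₂)
    (by
      intro c
      have h := htot _ hex₂ c
      have := hcount₂ c
      have e1 : ({i₁, i₂} : Multiset V) + C₂ = i₁ ::ₘ i₂ ::ₘ C₂ := by simp
      have e2 : ({i₁, i₂} : Multiset V).map (branch v) = {c₁, c₂} := by simp [hb₁, hb₂]
      rw [e1, e2, h]
      omega)
    (by
      obtain ⟨x, hx⟩ := Multiset.card_pos_iff_exists_mem.1 (by omega : 0 < C₂.card)
      exact ⟨x, hx, by simp⟩)
    (by
      rintro i j C' rfl hvj hbj -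
      have hlb : ∀ x ∈ ({i₁, i₂} : Multiset V) + j ::ₘ C', v ≤ x := by
        intro x hx
        simp only [Multiset.mem_add, Multiset.mem_cons, Multiset.insert_eq_cons,
          Multiset.mem_singleton] at hx
        rcases hx with (rfl | rfl) | rfl | hx
        · exact hvi₁
        · exact hK₂ _ (by simp)
        · exact hvj
        · exact hK₂ _ (by simp [hx])
      rw [isMeet_iff_branch (by simp) hlb]
      intro c hc
      by_contra! hall
      exact hne12 c hc (hb₁.symm.trans (hall i₁ (by simp))) (hb₂.symm.trans (hall i₂ (by simp))))
  have hC₃ : C₃ = 0 := by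
    rw [← Multiset.card_eq_zero]
    omega
  subst hC₃
  refine ⟨_, R₃, hex₂.trans (by simpa using hex₃), hm₃, ?_⟩
  rw [if_neg hk2]
  simp [hb₁, hb₂, hb₃]

omit [IsPolyforest V] [Fintype V] in
/-- Exchanges do not change the set of meets. -/
theorem Exchange.exists_meet_eq {U U' : Multiset (Multiset V)} (h : Exchange U U')
    {N : Multiset V} (hN : N ∈ U') : ∃ N' ∈ U, meet N' = meet N := by
  obtain ⟨i, j, C, D, R, s, t, rfl, rfl, h3, h4, h5, h6⟩ := h
  rcases Multiset.mem_cons.1 hN with rfl | hN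
  · exact ⟨i ::ₘ C, by simp, by rw [h3.meet_eq, h4.meet_eq]⟩
  rcases Multiset.mem_cons.1 hN with rfl | hN
  · exact ⟨j ::ₘ D, by simp, by rw [h5.meet_eq, h6.meet_eq]⟩
  · exact ⟨N, by simp [hN], rfl⟩

omit [IsPolyforest V] [Fintype V] in
theorem Exchanges.exists_meet_eq {U U' : Multiset (Multiset V)} (h : Exchanges U U')
    {N : Multiset V} (hN : N ∈ U') : ∃ N' ∈ U, meet N' = meet N := by
  induction h generalizing N with
  | refl => exact ⟨N, hN, rfl⟩
  | tail _ h ih =>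
    obtain ⟨N', hN', e⟩ := h.exists_meet_eq hN
    obtain ⟨N'', hN'', e'⟩ := ih hN'
    exact ⟨N'', hN'', e'.trans e⟩

/-- If no meet lies strictly above `v`, then a path of a box with meet `v` can be rerouted at
`w > v` along any branch on which a path outside of `K` exists. -/
theorem exists_exchanges_branch_eq {v w c i : V} {K C : Multiset V} {R : Multiset (Multiset V)}
    (hU : IsAdmissible ((K + i ::ₘ C) ::ₘ R)) (hm : IsMeet (K + i ::ₘ C) v)
    (htop : ∀ N ∈ (K + i ::ₘ C) ::ₘ R, ¬ v < meet N) (hvw : v < w) (hwi : w ≤ i)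
    (hcount : branchCount w c v K < totalBranchCount w c ((K + i ::ₘ C) ::ₘ R)) :
    ∃ j C' R', Exchanges ((K + i ::ₘ C) ::ₘ R) ((K + j ::ₘ C') ::ₘ R') ∧
      IsMeet (K + j ::ₘ C') v ∧ w ≤ j ∧ branch w j = c ∧
      (j ::ₘ C').map (branch v) = (i ::ₘ C).map (branch v) := by
  rw [totalBranchCount_cons, hm.meet_eq, branchCount_add] at hcount
  rcases Nat.eq_zero_or_pos (branchCount w c v (i ::ₘ C)) with h0 | h0
  · obtain ⟨N, hN, hpos⟩ := totalBranchCount_pos (by omega : 0 < totalBranchCount w c R)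
    obtain ⟨hNw, j, hj, hwj, hb⟩ := branchCount_pos hpos
    obtain ⟨D, rfl⟩ := Multiset.exists_cons_of_mem hj
    obtain ⟨R₀, rfl⟩ := Multiset.exists_cons_of_mem hN
    -- A path through `w` starts at or below `w`, and not at `w`, because no meet lies strictly
    -- above `v`. So the swap happens strictly beyond both meets.
    have hlt : meet (j ::ₘ D) < w := by
      refine hNw.lt_of_ne ?_
      intro h
      exact htop _ (by simp) (h ▸ hvw)
    have hmD : IsMeet (j ::ₘ D) (meet (j ::ₘ D)) := hU.isMeet_meet (by simp)
    rw [Multiset.add_cons] at hm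
    have hnew := hm.exchange_of_lt hvw hwi hwj
    refine ⟨j, C, (i ::ₘ D) ::ₘ R₀, .single ?_, by rwa [Multiset.add_cons], hwj, hb, ?_⟩
    · exact ⟨i, j, K + C, D, R₀, v, meet (j ::ₘ D), by rw [Multiset.add_cons],
        by rw [Multiset.add_cons], hm, hnew, hmD, hmD.exchange_of_lt hlt hwj hwi⟩
    · rw [Multiset.map_cons, Multiset.map_cons, branch_eq_of_lt hvw hwi, branch_eq_of_lt hvw hwj]
  · obtain ⟨-, j, hj, hwj, hb⟩ := branchCount_pos h0
    obtain ⟨C', hC'⟩ := Multiset.exists_cons_of_mem hj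
    rw [hC'] at hm ⊢
    exact ⟨j, C', R, .refl, hm, hwj, hb, rfl⟩

/-- Two boxes with meet `v` whose ends `i`, `i'` lie above `w > v`: the end `i` can be replaced
by `i'`. -/
theorem exists_exchanges_end_eq {v w i i' : V} {K C C' : Multiset V}
    {R R' : Multiset (Multiset V)} (hU : IsAdmissible ((K + i ::ₘ C) ::ₘ R))
    (hm : IsMeet (K + i ::ₘ C) v) (htop : ∀ N ∈ (K + i ::ₘ C) ::ₘ R, ¬ v < meet N)
    (hW : IsAdmissible ((K + i' ::ₘ C') ::ₘ R')) (hm' : IsMeet (K + i' ::ₘ C') v)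
    (hwt : weight ((K + i ::ₘ C) ::ₘ R) = weight ((K + i' ::ₘ C') ::ₘ R'))
    (hvw : v < w) (hwi : w ≤ i) (hwi' : w ≤ i') :
    ∃ C₁ R₁, Exchanges ((K + i ::ₘ C) ::ₘ R) ((K + i' ::ₘ C₁) ::ₘ R₁) ∧
      IsMeet (K + i' ::ₘ C₁) v ∧ (i' ::ₘ C₁).map (branch v) = (i ::ₘ C).map (branch v) := by
  induction w using WellFoundedGT.induction generalizing i C R with
  | ind w ih =>
    -- The target box has, besides the paths of `K`, one along this branch, and the total counts
    -- agree on both sides.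
    have hcount : branchCount w (branch w i') v K <
        totalBranchCount w (branch w i') ((K + i ::ₘ C) ::ₘ R) := by
      rw [totalBranchCount_eq_of_weight_eq hU hW hwt, totalBranchCount_cons, hm'.meet_eq,
        branchCount_add, branchCount_cons_of_eq C' hvw.le hwi']
      omega
    obtain ⟨j, C₁, R₁, hex, hm₁, hwj, hb, hmap⟩ :=
      exists_exchanges_branch_eq hU hm htop hvw hwi hcount
    -- Either `i' = w`, and the rerouted path ends at `w` too, or both ends lie above the next
    -- vertex on the way to `i'` and the induction continues from there.
    rcases hwi'.eq_or_lt with rfl | hlt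
    · rw [branch_self] at hb
      obtain rfl := (branch_eq_self_iff hwj).1 hb
      exact ⟨C₁, R₁, hex, hm₁, hmap⟩
    · obtain ⟨hcov, hle⟩ := branch_spec hlt
      have hle' : branch w i' ≤ j := hb ▸ branch_le hwj
      obtain ⟨C₂, R₂, hex₂, hm₂, hmap₂⟩ := ih _ hcov.lt (hex.isAdmissible hU) hm₁
        (fun N hN => by
          obtain ⟨N', hN', e⟩ := hex.exists_meet_eq hN
          exact e ▸ htop N' hN')
        (hex.weight_eq.symm.trans hwt) (hvw.trans hcov.lt) hle' hle
      exact ⟨C₂, R₂, hex.trans hex₂, hm₂, hmap₂.trans hmap⟩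

/-- Boxes with a meet `v` such that no other meet lies strictly above `v` can be made equal if
their branches at `v` agree. -/
theorem exists_exchanges_box_eq {v : V} {K C C' : Multiset V} {R R' : Multiset (Multiset V)}
    (hU : IsAdmissible ((K + C) ::ₘ R)) (hm : IsMeet (K + C) v)
    (htop : ∀ N ∈ (K + C) ::ₘ R, ¬ v < meet N)
    (hW : IsAdmissible ((K + C') ::ₘ R')) (hm' : IsMeet (K + C') v)
    (hwt : weight ((K + C) ::ₘ R) = weight ((K + C') ::ₘ R'))
    (hmap : C.map (branch v) = C'.map (branch v)) :
    ∃ R₁, Exchanges ((K + C) ::ₘ R) ((K + C') ::ₘ R₁) := by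
  classical
  induction C' using Multiset.induction_on generalizing C K R with
  | empty =>
    rw [Multiset.map_zero, Multiset.map_eq_zero] at hmap
    subst hmap
    exact ⟨R, .refl⟩
  | cons i' C'' ih =>
    rw [Multiset.map_cons] at hmap
    obtain ⟨i, hi, hb, -⟩ := (Multiset.map_eq_cons _ _ _ _).2 hmap
    obtain ⟨C₀, rfl⟩ := Multiset.exists_cons_of_mem hi
    have hvi : v ≤ i := hm.1 _ (by simp)
    have hvi' : v ≤ i' := hm'.1 _ (by simp)
    obtain ⟨C₁, R₁, hex, hm₁, hmap₁⟩ : ∃ C₁ R₁,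
        Exchanges ((K + i ::ₘ C₀) ::ₘ R) ((K + i' ::ₘ C₁) ::ₘ R₁) ∧
        IsMeet (K + i' ::ₘ C₁) v ∧ (i' ::ₘ C₁).map (branch v) = (i ::ₘ C₀).map (branch v) := by
      rcases hvi'.eq_or_lt with rfl | hlt
      · rw [branch_self, branch_eq_self_iff hvi] at hb
        subst hb
        exact ⟨C₀, R, .refl, hm, rfl⟩
      · obtain ⟨hcov, hle⟩ := branch_spec hlt
        exact exists_exchanges_end_eq hU hm htop hW hm' hwt hcov.lt (hb ▸ branch_le hvi) hle
    have hmap₂ : C₁.map (branch v) = C''.map (branch v) := by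
      rw [Multiset.map_cons] at hmap₁
      exact (Multiset.cons_inj_right _).1 (hmap₁.trans hmap)
    have hassoc : ∀ D : Multiset V, K + i' ::ₘ D = (K + {i'}) + D := fun D => by
      rw [add_assoc, Multiset.singleton_add]
    have hU₁ := hex.isAdmissible hU
    have hwt₁ := hex.weight_eq.symm.trans hwt
    have htop₁ : ∀ N ∈ (K + i' ::ₘ C₁) ::ₘ R₁, ¬ v < meet N := fun N hN => by
      obtain ⟨N', hN', e⟩ := hex.exists_meet_eq hN
      exact e ▸ htop N' hN'
    rw [hassoc] at hex hm₁ hU₁ hwt₁ htop₁ hW hm' ⊢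
    rw [hassoc C''] at hwt₁
    obtain ⟨R₂, hex₂⟩ := ih hU₁ hm₁ htop₁ hW hm' hwt₁ hmap₂
    exact ⟨R₂, hex.trans hex₂⟩

/-- Multisets of boxes with the same weight are connected by exchanges. -/
theorem exchanges_of_weight_eq {U W : Multiset (Multiset V)} (hU : IsAdmissible U)
    (hW : IsAdmissible W) (h : weight U = weight W) : Exchanges U W := by
  induction hn : U.card generalizing U W with
  | zero =>
    rw [Multiset.card_eq_zero] at hn
    subst hn
    rcases W.empty_or_exists_mem with rfl | ⟨M, hM⟩
    · exact .refl
    · obtain ⟨N, hN, -⟩ := exists_mem_of_weight_eq h.symm hM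
      simp at hN
  | succ m ih =>
    obtain ⟨M₀, hM₀⟩ := Multiset.card_pos_iff_exists_mem.1 (by omega : 0 < U.card)
    -- A maximal meet leaves no path starting strictly above `v`, as the rerouting requires.
    obtain ⟨v, ⟨M, hM, hMv⟩, hmax⟩ :=
      (Set.toFinite {v | ∃ M ∈ U, meet M = v}).exists_maximal ⟨_, M₀, hM₀, rfl⟩
    obtain ⟨M', hM', hcard, hM'v⟩ := exists_mem_of_weight_eq h hM
    rw [hMv] at hM'v
    obtain ⟨T, hT⟩ := exists_normal_branches v (fun c => totalBranchCount v c U) M.card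
    obtain ⟨N, R, hex, hN, hNT⟩ := hT U hU (fun _ => rfl) M hM rfl hMv
    obtain ⟨N', R', hex', hN', hN'T⟩ := hT W hW
      (fun c => totalBranchCount_eq_of_weight_eq hW hU h.symm v c) M' hM' hcard hM'v
    have htop : ∀ B ∈ N ::ₘ R, ¬ v < meet B := fun B hB hlt => by
      obtain ⟨B', hB', e⟩ := hex.exists_meet_eq hB
      exact hlt.not_ge (hmax ⟨B', hB', e⟩ hlt.le)
    have hwt : weight (N ::ₘ R) = weight (N' ::ₘ R') :=
      (hex.weight_eq.symm.trans h).trans hex'.weight_eq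
    have hA := hex.isAdmissible hU
    have hA' := hex'.isAdmissible hW
    obtain ⟨R₁, hex₁⟩ := exists_exchanges_box_eq (K := 0) (C := N) (C' := N') (v := v) (R := R)
      (R' := R') (by simpa using hA) (by simpa using hN) (by simpa using htop) (by simpa using hA')
      (by simpa using hN') (by simpa using hwt) (hNT.trans hN'T.symm)
    rw [zero_add, zero_add] at hex₁
    have hcd : ∀ {U U' : Multiset (Multiset V)}, Exchanges U U' → U.card = U'.card := by
      intro U U' h
      induction h with
      | refl => rfl
      | tail _ h ih =>
        obtain ⟨i, j, C, D, R, s, t, rfl, rfl, -⟩ := h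
        simpa using ih
    have hrest : weight R₁ = weight R' := by
      have := hex₁.weight_eq.symm.trans hwt
      rw [weight_cons, weight_cons] at this
      exact add_left_cancel this
    have hc := hcd (hex.trans hex₁)
    rw [Multiset.card_cons, hn] at hc
    have hfin := ih (hex₁.isAdmissible hA).of_cons hA'.of_cons hrest (by omega)
    exact (hex.trans hex₁).trans ((hfin.cons N').trans hex'.symm)

end Connectivity

end ThirdMoment

namespace ThirdMoment

/-! ### Polytrees as polyforest orders; tops as meets -/

section Reachability

variable {V : Type*}

/-- The reachability order of an acyclic directed graph. -/
abbrev reachOrder (G : Digraph V) (h : IsAcyclic G) : PartialOrder V where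
  le a b := Relation.ReflTransGen G.Adj a b
  le_refl _ := .refl
  le_trans _ _ _ := .trans
  le_antisymm a b hab hba := by
    rcases Relation.reflTransGen_iff_eq_or_transGen.1 hab with h1 | h1
    · exact h1.symm
    · exact absurd (h1.trans_left hba) (h a)

/-- Removing an edge of a polytree separates it into two parts. -/
theorem IsPolytree.exists_cut {G : Digraph V} (hG : IsPolytree G) {v c : V} (hvc : G.Adj v c) :
    ∃ K : Set V, c ∈ K ∧ v ∉ K ∧ ∀ a b, G.Adj a b → (a, b) ≠ (v, c) → (a ∈ K ↔ b ∈ K) := by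
  have hne : ∀ {a b}, G.Adj a b → a ≠ b := by
    rintro a b h rfl
    exact hG.1 a (.single h)
  set H := G.toSimpleGraphInclusive with hH
  have hadj : ∀ {a b}, G.Adj a b → H.Adj a b := fun h => ⟨hne h, Or.inl h⟩
  refine ⟨{x | (H.deleteEdges {s(v, c)}).Reachable x c}, .refl _, ?_, ?_⟩
  · exact SimpleGraph.isBridge_iff.1
      (SimpleGraph.isAcyclic_iff_forall_adj_isBridge.1 hG.2.isAcyclic (hadj hvc))
  · intro a b hab hdiff
    have hr : (H.deleteEdges {s(v, c)}).Adj a b := by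
      rw [SimpleGraph.deleteEdges_adj]
      refine ⟨hadj hab, ?_⟩
      simp only [Set.mem_singleton_iff, Sym2.eq_iff, not_or, not_and]
      refine ⟨fun h1 h2 => hdiff (by rw [h1, h2]), ?_⟩
      rintro rfl rfl
      exact hG.1 a ((Relation.TransGen.single hab).tail hvc)
    exact ⟨fun h => hr.symm.reachable.trans h, fun h => hr.reachable.trans h⟩

variable [PartialOrder V] {G : Digraph V}

theorem lt_of_adj (hG : IsAcyclic G) (hle : ∀ a b : V, a ≤ b ↔ Relation.ReflTransGen G.Adj a b)
    {a b : V} (h : G.Adj a b) : a < b := by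
  refine lt_of_le_of_ne ((hle _ _).2 (.single h)) ?_
  rintro rfl
  exact hG a (.single h)

/-- Cut the edge from `v` to `c` and let `K` be the side of `c`. Directed paths never leave `K` and
enter it only through `v`. Now `i` is in `K`, while `c'` and `j` are not, since otherwise `c' ≤ v`.
As `w ≤ j`, also `w` is outside, so the path from `w` to `i` passes `v`. -/
theorem IsPolytree.le_of_branch_adj (hG : IsPolytree G)
    (hle : ∀ a b : V, a ≤ b ↔ Relation.ReflTransGen G.Adj a b) {v c c' i j w : V}
    (hc : G.Adj v c) (hc' : G.Adj v c') (hne : c ≠ c') (hci : c ≤ i) (hcj : c' ≤ j) (hwi : w ≤ i)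
    (hwj : w ≤ j) : w ≤ v := by
  obtain ⟨K, hcK, hvK, hK⟩ := hG.exists_cut hc
  have hcross : ∀ {x y : V}, x ≤ y → (x ∈ K → y ∈ K) ∧ (x ∉ K → y ∈ K → x ≤ v ∧ c ≤ y) := by
    intro x y hxy
    rw [hle] at hxy
    induction hxy with
    | refl => exact ⟨id, fun h h' => absurd h' h⟩
    | @tail a b hxa hab ih =>
      by_cases he : (a, b) = (v, c)
      · obtain ⟨rfl, rfl⟩ := Prod.ext_iff.1 he
        exact ⟨fun _ => hcK, fun _ _ => ⟨(hle _ _).2 hxa, le_rfl⟩⟩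
      · have := hK a b hab he
        refine ⟨fun h => this.1 (ih.1 h), fun h h' => ?_⟩
        have h2 := ih.2 h (this.2 h')
        exact ⟨h2.1, h2.2.trans ((hle _ _).2 (.single hab))⟩
  have hiK : i ∈ K := (hcross hci).1 hcK
  have hc'K : c' ∉ K := fun h => hvK ((hK v c' hc' (by simp [hne.symm])).2 h)
  have hjK : j ∉ K := fun h =>
    (lt_of_adj hG.1 hle hc').not_ge ((hcross hcj).2 hc'K h).1
  have hwK : w ∉ K := fun h => hjK ((hcross hwj).1 h)
  exact ((hcross hwi).2 hwK hiK).1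

theorem IsPolytree.adj_of_covBy (hG : IsPolytree G)
    (hle : ∀ a b : V, a ≤ b ↔ Relation.ReflTransGen G.Adj a b) {v c : V} (h : v ⋖ c) :
    G.Adj v c := by
  rcases ((hle _ _).1 h.le).cases_head with h' | ⟨x, hx, hxc⟩
  · exact absurd h' h.ne
  · rcases ((hle _ _).2 hxc).eq_or_lt with rfl | hlt
    · exact hx
    · exact absurd hlt (h.2 (lt_of_adj hG.1 hle hx))

theorem IsPolytree.isPolyforest (hG : IsPolytree G)
    (hle : ∀ a b : V, a ≤ b ↔ Relation.ReflTransGen G.Adj a b) : IsPolyforest V where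
  le_of_branch hc hc' :=
    hG.le_of_branch_adj hle (hG.adj_of_covBy hle hc) (hG.adj_of_covBy hle hc')

/-- An edge cannot be bypassed: a vertex strictly between `v` and `c` would yield a second first
step `y ≤ c`, and branching at `v` would give `c ≤ v`. -/
theorem IsPolytree.covBy_iff_adj (hG : IsPolytree G)
    (hle : ∀ a b : V, a ≤ b ↔ Relation.ReflTransGen G.Adj a b) {v c : V} : v ⋖ c ↔ G.Adj v c := by
  refine ⟨hG.adj_of_covBy hle, fun h => ⟨lt_of_adj hG.1 hle h, fun x hvx hxc => ?_⟩⟩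
  rcases ((hle _ _).1 hvx.le).cases_head with h' | ⟨y, hy, hyx⟩
  · exact hvx.ne h'
  have hyx : y ≤ x := (hle _ _).2 hyx
  have hne : c ≠ y := by
    rintro rfl
    exact hxc.not_ge hyx
  exact (lt_of_adj hG.1 hle h).not_ge
    (hG.le_of_branch_adj hle h hy hne le_rfl (hyx.trans hxc.le) le_rfl le_rfl)

/-! ### Treks in terms of the order -/

omit [PartialOrder V] in
theorem IsDirectedPath.eq_or_exists {v w : V} {l : List V} (h : IsDirectedPath G v w l) :
    (l = [v] ∧ v = w) ∨ ∃ y t, l = v :: y :: t ∧ G.Adj v y ∧ IsDirectedPath G y w (y :: t) := by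
  obtain ⟨h1, h2, h3⟩ := h
  match l with
  | [] => simp at h2
  | [x] =>
    left
    simp at h2 h3
    exact ⟨by rw [h2], h2.symm.trans h3⟩
  | x :: y :: t =>
    right
    simp only [List.head?_cons, Option.some.injEq] at h2
    subst h2
    rw [List.isChain_cons_cons] at h1
    exact ⟨y, t, rfl, h1.1, h1.2, rfl, by simpa using h3⟩

theorem IsDirectedPath.le_of_mem
    (hle : ∀ a b : V, a ≤ b ↔ Relation.ReflTransGen G.Adj a b) {v w x : V} {l : List V}
    (h : IsDirectedPath G v w l) (hx : x ∈ l) : v ≤ x ∧ x ≤ w := by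
  induction l generalizing v x with
  | nil => simp at hx
  | cons a l ih =>
    rcases h.eq_or_exists with ⟨h1, rfl⟩ | ⟨y, t, h1, hadj, hp⟩
    · rw [h1, List.mem_singleton] at hx
      simp [hx]
    · have hvy : v ≤ y := (hle _ _).2 (.single hadj)
      obtain ⟨rfl, rfl⟩ := List.cons_eq_cons.1 h1
      have hyw : y ≤ w := (ih hp (by simp)).2
      rcases List.mem_cons.1 hx with rfl | hx
      · exact ⟨le_rfl, hvy.trans hyw⟩
      · exact ⟨hvy.trans (ih hp hx).1, (ih hp hx).2⟩

theorem IsDirectedPath.le (hle : ∀ a b : V, a ≤ b ↔ Relation.ReflTransGen G.Adj a b) {v w : V}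
    {l : List V} (h : IsDirectedPath G v w l) : v ≤ w := by
  have hv : v ∈ l := List.mem_of_mem_head? h.2.1
  exact (h.le_of_mem hle hv).2

theorem exists_isDirectedPath (hle : ∀ a b : V, a ≤ b ↔ Relation.ReflTransGen G.Adj a b) {v w : V}
    (h : v ≤ w) : ∃ l, IsDirectedPath G v w l := by
  rw [hle] at h
  induction h using Relation.ReflTransGen.head_induction_on with
  | refl => exact ⟨[w], by simp, rfl, rfl⟩
  | @head a c hac _ ih =>
    obtain ⟨l, h1, h2, h3⟩ := ih
    refine ⟨a :: l, ?_, rfl, ?_⟩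
    · rw [List.isChain_cons]
      refine ⟨fun y hy => ?_, h1⟩
      rw [h2, Option.mem_some_iff] at hy
      exact hy ▸ hac
    · cases l with
      | nil => simp at h2
      | cons b t => simpa using h3

theorem hasTrek_iff (hle : ∀ a b : V, a ≤ b ↔ Relation.ReflTransGen G.Adj a b) {k : ℕ}
    {i : Fin k → V} : HasTrek G i ↔ ∃ v, ∀ r, v ≤ i r := by
  constructor
  · rintro ⟨τ⟩
    exact ⟨τ.top, fun r => (τ.isDirectedPath r).le hle⟩
  · rintro ⟨v, hv⟩
    choose l hl using fun r => exists_isDirectedPath hle (hv r)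
    exact ⟨⟨v, l, hl⟩⟩

/-- If the top is not the meet, all paths share their first edge, so the trek is not simple.
Conversely, a vertex on all paths is a lower bound of the sinks, hence at most the meet. Only the
set of elements of `M` matters. -/
theorem IsPolytree.isTop_iff [Finite V] (hG : IsPolytree G)
    (hle : ∀ a b : V, a ≤ b ↔ Relation.ReflTransGen G.Adj a b) {k : ℕ} {i : Fin k → V} {v : V}
    {M : Multiset V} (hM : M ≠ 0) (hi : ∀ x, x ∈ M ↔ ∃ r, i r = x) :
    IsTop G i v ↔ IsMeet M v := by
  have := hG.isPolyforest hle
  constructor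
  · rintro ⟨τ, hτ, rfl⟩
    have hlb : ∀ x ∈ M, τ.top ≤ x := by
      intro x hx
      obtain ⟨r, rfl⟩ := (hi x).1 hx
      exact (τ.isDirectedPath r).le hle
    rw [isMeet_iff_branch hM hlb]
    intro c hc
    by_contra! hall
    refine hc.ne' (hτ c fun r => ?_)
    have hb := hall (i r) ((hi _).2 ⟨r, rfl⟩)
    rcases (τ.isDirectedPath r).eq_or_exists with ⟨-, h⟩ | ⟨y, t, h1, hadj, hp⟩
    · rw [← h, branch_self] at hb
      exact absurd hb hc.ne
    · rw [branch_eq_of_covBy ((hG.covBy_iff_adj hle).2 hadj) (hp.le hle)] at hb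
      rw [h1, hb]
      simp
  · intro h
    choose l hl using fun r => exists_isDirectedPath hle (h.1 (i r) ((hi _).2 ⟨r, rfl⟩))
    refine ⟨⟨v, l, hl⟩, fun x hx => ?_, rfl⟩
    obtain ⟨y, hy⟩ := Multiset.exists_mem_of_ne_zero hM
    obtain ⟨r₀, -⟩ := (hi y).1 hy
    refine le_antisymm (h.2 x fun z hz => ?_) ((hl r₀).le_of_mem hle (hx r₀)).1
    obtain ⟨r, rfl⟩ := (hi z).1 hz
    exact ((hl r).le_of_mem hle (hx r)).2

end Reachability

end ThirdMoment

namespace ThirdMoment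

open MvPolynomial

/-! ### Dictionary: indeterminates and boxes, 2-minors and exchanges -/

section Boxes

variable {V : Type*}

/-- The multiset of vertices that index an indeterminate. -/
def varBox : MomentVar V → Multiset V :=
  Sum.elim Sym2.toMultiset fun t => (t : Multiset V)

theorem varBox_sVar (i j : V) : varBox (sVar i j) = i ::ₘ {j} := rfl

theorem varBox_tVar (i j k : V) : varBox (tVar i j k) = i ::ₘ {j, k} := rfl

theorem eq_sVar_or_eq_tVar (x : MomentVar V) :
    (∃ i j, x = sVar i j) ∨ ∃ i j k, x = tVar i j k := by
  rcases x with z | t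
  · induction z with
    | h i j => exact Or.inl ⟨i, j, rfl⟩
  · obtain ⟨i, t, rfl⟩ := t.exists_eq_cons_of_succ
    obtain ⟨j, t, rfl⟩ := t.exists_eq_cons_of_succ
    obtain ⟨k, t, rfl⟩ := t.exists_eq_cons_of_succ
    obtain rfl := Sym.eq_nil_of_card_zero t
    exact Or.inr ⟨i, j, k, rfl⟩

theorem card_varBox (x : MomentVar V) : (varBox x).card = 2 ∨ (varBox x).card = 3 := by
  rcases eq_sVar_or_eq_tVar x with ⟨i, j, rfl⟩ | ⟨i, j, k, rfl⟩
  · simp [varBox_sVar]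
  · simp [varBox_tVar]

theorem varBox_injective : Function.Injective (varBox : MomentVar V → Multiset V) := by
  classical
  rintro (z | t) (z' | t') h
  · induction z with
    | h i j =>
      induction z' with
      | h k l =>
        change (i ::ₘ {j} : Multiset V) = k ::ₘ {l} at h
        congr 1
        rw [Sym2.eq_iff]
        rw [Multiset.cons_eq_cons] at h
        rcases h with ⟨rfl, h⟩ | ⟨-, cs, h1, h2⟩
        · exact Or.inl ⟨rfl, by simpa using h⟩
        · have : cs = 0 := by
            have := congrArg Multiset.card h1
            simpa using this
          subst this
          simp at h1 h2
          exact Or.inr ⟨h2.symm, h1⟩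
  · have := congrArg Multiset.card h
    simp [varBox, Sym2.card_toMultiset] at this
  · have := congrArg Multiset.card h
    simp [varBox, Sym2.card_toMultiset] at this
  · exact congrArg Sum.inr (Sym.coe_injective h)

end Boxes

section Monomials

theorem toMultiset_injective {σ : Type*} :
    Function.Injective (Finsupp.toMultiset : (σ →₀ ℕ) → Multiset σ) := by
  classical
  exact Multiset.toFinsupp.symm.injective

variable {σ 𝕜 : Type*} [CommRing 𝕜]

theorem monomial_one_eq_prod (u : σ →₀ ℕ) :
    monomial u (1 : 𝕜) = ((Finsupp.toMultiset u).map X).prod := by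
  induction u using Finsupp.induction_linear with
  | zero => simp
  | add u v hu hv => rw [map_add, Multiset.map_add, Multiset.prod_add, ← hu, ← hv, monomial_mul,
      one_mul]
  | single x n => simp [X_pow_eq_monomial, Finsupp.toMultiset_single, Multiset.map_nsmul,
      Multiset.prod_nsmul]

theorem monomial_sub_mem_of_eqvGen {B : Set (MvPolynomial σ 𝕜)} {u v : σ →₀ ℕ}
    (h : Relation.EqvGen (MarkovMove B) u v) :
    monomial u (1 : 𝕜) - monomial v 1 ∈ Ideal.span B := by
  induction h with
  | rel u v h =>
    obtain ⟨a, b, c, hB, rfl, rfl⟩ := h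
    have : monomial (c + a) (1 : 𝕜) - monomial (c + b) 1 =
        monomial c 1 * (monomial a 1 - monomial b 1) := by
      rw [mul_sub, monomial_mul, monomial_mul, one_mul]
    rw [this]
    exact Ideal.mul_mem_left _ _ (Ideal.subset_span hB)
  | refl u => simp
  | symm u v _ ih => rw [← neg_sub]; exact neg_mem ih
  | trans u v w _ _ h1 h2 =>
    rw [← sub_add_sub_cancel]
    exact add_mem h1 h2

end Monomials

section Columns

variable {V : Type*} [PartialOrder V] [Finite V] {G : Digraph V}

theorem IsPolytree.hasTrek_iff_exists_isMeet (hG : IsPolytree G)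
    (hle : ∀ a b : V, a ≤ b ↔ Relation.ReflTransGen G.Adj a b) {k : ℕ} {i : Fin k → V}
    {M : Multiset V} (hM : M ≠ 0) (hi : ∀ x, x ∈ M ↔ ∃ r, i r = x) :
    HasTrek G i ↔ ∃ v, IsMeet M v := by
  have := hG.isPolyforest hle
  rw [hasTrek_iff hle]
  constructor
  · rintro ⟨v, hv⟩
    refine exists_isMeet hM (u := v) fun x hx => ?_
    obtain ⟨r, rfl⟩ := (hi x).1 hx
    exact hv r
  · rintro ⟨v, hv⟩
    exact ⟨v, fun r => hv.1 _ ((hi _).2 ⟨r, rfl⟩)⟩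

omit [PartialOrder V] [Finite V] in
theorem mem_pair_iff (i j x : V) : x ∈ (i ::ₘ {j} : Multiset V) ↔ ∃ r, ![i, j] r = x := by
  simp [Fin.exists_fin_two, eq_comm]

omit [PartialOrder V] [Finite V] in
theorem mem_triple_iff (i j k x : V) :
    x ∈ (i ::ₘ {j, k} : Multiset V) ↔ ∃ r, ![i, j, k] r = x := by
  simp [Fin.exists_fin_succ, eq_comm]

/-- The columns of the trek-matrix `A_{i,j}` correspond to the multisets that have the same meet
when completed by `i` and by `j`. -/
theorem IsPolytree.exists_isMeet_of_trekColumn (hG : IsPolytree G)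
    (hle : ∀ a b : V, a ≤ b ↔ Relation.ReflTransGen G.Adj a b) {i j : V} (c : TrekColumn G i j) :
    ∃ (C : Multiset V) (s : V), (∀ r, varBox (trekEntry r c) = r ::ₘ C) ∧
      IsMeet (i ::ₘ C) s ∧ IsMeet (j ::ₘ C) s := by
  rcases c with ⟨k, s, h1, h2⟩ | ⟨⟨l, m⟩, s, h1, h2⟩
  · exact ⟨{k}, s, fun r => rfl, (hG.isTop_iff hle (by simp) (mem_pair_iff i k)).1 h1,
      (hG.isTop_iff hle (by simp) (mem_pair_iff j k)).1 h2⟩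
  · exact ⟨{l, m}, s, fun r => rfl, (hG.isTop_iff hle (by simp) (mem_triple_iff i l m)).1 h1,
      (hG.isTop_iff hle (by simp) (mem_triple_iff j l m)).1 h2⟩

theorem IsPolytree.exists_trekColumn (hG : IsPolytree G)
    (hle : ∀ a b : V, a ≤ b ↔ Relation.ReflTransGen G.Adj a b) {i j s : V} {C : Multiset V}
    (hC : C.card = 1 ∨ C.card = 2) (h1 : IsMeet (i ::ₘ C) s) (h2 : IsMeet (j ::ₘ C) s) :
    ∃ c : TrekColumn G i j, ∀ r, varBox (trekEntry r c) = r ::ₘ C := by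
  rcases hC with hC | hC
  · obtain ⟨k, rfl⟩ := Multiset.card_eq_one.1 hC
    exact ⟨Sum.inl ⟨k, s, (hG.isTop_iff hle (by simp) (mem_pair_iff i k)).2 h1,
      (hG.isTop_iff hle (by simp) (mem_pair_iff j k)).2 h2⟩, fun r => rfl⟩
  · obtain ⟨l, m, rfl⟩ := Multiset.card_eq_two.1 hC
    exact ⟨Sum.inr ⟨(l, m), s, (hG.isTop_iff hle (by simp) (mem_triple_iff i l m)).2 h1,
      (hG.isTop_iff hle (by simp) (mem_triple_iff j l m)).2 h2⟩, fun r => rfl⟩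

omit [PartialOrder V] [Finite V] in
theorem det_trekMatrix (𝕜 : Type*) [CommRing 𝕜] {i j : V} (c d : TrekColumn G i j) :
    ((trekMatrix 𝕜 G i j).submatrix id ![c, d]).det =
      monomial (Finsupp.single (trekEntry i c) 1 + Finsupp.single (trekEntry j d) 1) 1 -
        monomial (Finsupp.single (trekEntry j c) 1 + Finsupp.single (trekEntry i d) 1) 1 := by
  have h : ∀ x y : MomentVar V, monomial (Finsupp.single x 1 + Finsupp.single y 1) (1 : 𝕜) =
      X x * X y := fun x y => by
    rw [X, X, monomial_mul, one_mul]
  rw [Matrix.det_fin_two, h, h]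
  simp only [trekMatrix, Matrix.submatrix_apply, Matrix.of_apply, id, Matrix.cons_val_zero,
    Matrix.cons_val_one]
  ring

/-- The indeterminates among the generators are those whose vertices have no meet. -/
theorem IsPolytree.X_mem_linearGenerators (𝕜 : Type*) [CommRing 𝕜] (hG : IsPolytree G)
    (hle : ∀ a b : V, a ≤ b ↔ Relation.ReflTransGen G.Adj a b) {x : MomentVar V}
    (hx : ¬ ∃ v, IsMeet (varBox x) v) : X x ∈ linearGenerators 𝕜 G := by
  rcases eq_sVar_or_eq_tVar x with ⟨i, j, rfl⟩ | ⟨i, j, k, rfl⟩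
  · exact Or.inl ⟨i, j,
      (hG.hasTrek_iff_exists_isMeet hle (by simp) (mem_pair_iff i j)).not.2 hx, rfl⟩
  · exact Or.inr ⟨i, j, k,
      (hG.hasTrek_iff_exists_isMeet hle (by simp) (mem_triple_iff i j k)).not.2 hx, rfl⟩

theorem IsPolytree.exists_of_mem_linearGenerators {𝕜 : Type*} [CommRing 𝕜] (hG : IsPolytree G)
    (hle : ∀ a b : V, a ≤ b ↔ Relation.ReflTransGen G.Adj a b) {f : MvPolynomial (MomentVar V) 𝕜}
    (hf : f ∈ linearGenerators 𝕜 G) : ∃ x, f = X x ∧ ¬ ∃ v, IsMeet (varBox x) v := by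
  rcases hf with ⟨i, j, h, rfl⟩ | ⟨i, j, k, h, rfl⟩
  · exact ⟨_, rfl, (hG.hasTrek_iff_exists_isMeet hle (by simp) (mem_pair_iff i j)).not.1 h⟩
  · exact ⟨_, rfl, (hG.hasTrek_iff_exists_isMeet hle (by simp) (mem_triple_iff i j k)).not.1 h⟩

/-- Exchanges of boxes are moves along 2-minors of trek-matrices. -/
theorem IsPolytree.exists_markovMove (𝕜 : Type*) [CommRing 𝕜] (hG : IsPolytree G)
    (hle : ∀ a b : V, a ≤ b ↔ Relation.ReflTransGen G.Adj a b) {u : MomentVar V →₀ ℕ}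
    {U : Multiset (Multiset V)} (h : Exchange ((Finsupp.toMultiset u).map varBox) U) :
    ∃ v : MomentVar V →₀ ℕ, (Finsupp.toMultiset v).map varBox = U ∧
      MarkovMove (trekMinors 𝕜 G) u v := by
  classical
  obtain ⟨i, j, C, D, R, s, t, hu, rfl, h3, h4, h5, h6⟩ := h
  obtain ⟨x, hx, hxC, hu⟩ := (Multiset.map_eq_cons _ _ _ _).2 hu
  obtain ⟨y, hy, hyD, rfl⟩ := (Multiset.map_eq_cons _ _ _ _).2 hu
  set Z := ((Finsupp.toMultiset u).erase x).erase y with hZ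
  have hcard : ∀ {z : MomentVar V} {r : V} {C : Multiset V}, varBox z = r ::ₘ C →
      C.card = 1 ∨ C.card = 2 := by
    intro z r C hz
    have := card_varBox z
    rw [hz, Multiset.card_cons] at this
    omega
  obtain ⟨c, hc⟩ := hG.exists_trekColumn hle (hcard hxC) h3 h4
  obtain ⟨d, hd⟩ := hG.exists_trekColumn hle (hcard hyD) h6 h5
  obtain rfl : x = trekEntry i c := varBox_injective (by rw [hxC, hc])
  obtain rfl : y = trekEntry j d := varBox_injective (by rw [hyD, hd])
  have hu' : Finsupp.toMultiset u = trekEntry i c ::ₘ trekEntry j d ::ₘ Z := by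
    rw [hZ, Multiset.cons_erase hy, Multiset.cons_erase hx]
  refine ⟨Multiset.toFinsupp Z +
    (Finsupp.single (trekEntry j c) 1 + Finsupp.single (trekEntry i d) 1), ?_, _, _,
    Multiset.toFinsupp Z, ⟨i, j, ?_, c, d, (det_trekMatrix 𝕜 c d).symm⟩, ?_, rfl⟩
  · rw [map_add, map_add, Multiset.toFinsupp_toMultiset, Finsupp.toMultiset_single,
      Finsupp.toMultiset_single, one_smul, one_smul, add_comm, add_assoc, Multiset.singleton_add,
      Multiset.singleton_add, Multiset.map_cons, Multiset.map_cons, hc, hd]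
  · rw [hasTrek_iff hle]
    exact ⟨s, by simp [Fin.forall_fin_two, h3.1 i, h4.1 j]⟩
  · apply toMultiset_injective
    rw [hu', map_add, map_add, Multiset.toFinsupp_toMultiset, Finsupp.toMultiset_single,
      Finsupp.toMultiset_single, one_smul, one_smul, add_comm, add_assoc, Multiset.singleton_add,
      Multiset.singleton_add]

theorem IsPolytree.eqvGen_markovMove (𝕜 : Type*) [CommRing 𝕜] (hG : IsPolytree G)
    (hle : ∀ a b : V, a ≤ b ↔ Relation.ReflTransGen G.Adj a b) {u v : MomentVar V →₀ ℕ}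
    (h : Exchanges ((Finsupp.toMultiset u).map varBox) ((Finsupp.toMultiset v).map varBox)) :
    Relation.EqvGen (MarkovMove (trekMinors 𝕜 G)) u v := by
  have key : ∀ U, Exchanges ((Finsupp.toMultiset u).map varBox) U →
      ∃ w : MomentVar V →₀ ℕ, (Finsupp.toMultiset w).map varBox = U ∧
        Relation.EqvGen (MarkovMove (trekMinors 𝕜 G)) u w := by
    intro U hU
    induction hU with
    | refl => exact ⟨u, rfl, .refl u⟩
    | tail _ h ih =>
      obtain ⟨w, rfl, hw⟩ := ih
      obtain ⟨w', hw', hmove⟩ := hG.exists_markovMove 𝕜 hle h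
      exact ⟨w', hw', hw.trans _ _ _ (.rel _ _ hmove)⟩
  obtain ⟨w, hw, huw⟩ := key _ h
  have : w = v := toMultiset_injective ((Multiset.map_eq_map varBox_injective).1 hw)
  exact this ▸ huw

end Columns

/-! ### The monomial map, its kernel and the Markov basis -/

section TrekMap

variable {V : Type*} [PartialOrder V] [Fintype V] [Nonempty V] (𝕜 : Type*) [CommRing 𝕜]

open Classical in
/-- The monomial parametrization: an indeterminate is sent to the monomial of the simple trek
between its vertices, or to zero if there is no trek. -/
noncomputable def trekMap :
    MvPolynomial (MomentVar V) 𝕜 →ₐ[𝕜] MvPolynomial ((ℕ × V) ⊕ (V × V)) 𝕜 :=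
  aeval fun x => if ∃ v, IsMeet (varBox x) v then monomial (boxWeight (varBox x)) 1 else 0

variable {𝕜}

theorem trekMap_X_of_isMeet {x : MomentVar V} (h : ∃ v, IsMeet (varBox x) v) :
    trekMap 𝕜 (X x) = monomial (boxWeight (varBox x)) 1 := by
  rw [trekMap, aeval_X, if_pos h]

theorem trekMap_X_of_not {x : MomentVar V} (h : ¬ ∃ v, IsMeet (varBox x) v) :
    trekMap 𝕜 (X x) = 0 := by
  rw [trekMap, aeval_X, if_neg h]

omit [Fintype V] [Nonempty V] in
theorem isAdmissible_map_varBox {Z : Multiset (MomentVar V)}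
    (h : ∀ x ∈ Z, ∃ v, IsMeet (varBox x) v) : IsAdmissible (Z.map varBox) := by
  intro M hM
  obtain ⟨x, hx, rfl⟩ := Multiset.mem_map.1 hM
  exact ⟨card_varBox x, h x hx⟩

theorem trekMap_monomial {u : MomentVar V →₀ ℕ}
    (h : ∀ x ∈ Finsupp.toMultiset u, ∃ v, IsMeet (varBox x) v) :
    trekMap 𝕜 (monomial u 1) = monomial (weight ((Finsupp.toMultiset u).map varBox)) 1 := by
  rw [monomial_one_eq_prod, map_multiset_prod, Multiset.map_map]
  generalize Finsupp.toMultiset u = Z at h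
  induction Z using Multiset.induction_on with
  | empty => simp [weight]
  | cons x Z ih =>
    rw [Multiset.map_cons, Multiset.prod_cons, ih fun y hy => h y (by simp [hy]), Multiset.map_cons,
      weight_cons, Function.comp, trekMap_X_of_isMeet (h x (by simp)), monomial_mul, one_mul]

theorem trekMap_monomial_of_not {u : MomentVar V →₀ ℕ}
    (h : ¬ ∀ x ∈ Finsupp.toMultiset u, ∃ v, IsMeet (varBox x) v) :
    trekMap 𝕜 (monomial u 1) = 0 := by
  push Not at h
  obtain ⟨x, hx, hno⟩ := h
  rw [monomial_one_eq_prod, map_multiset_prod]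
  refine Multiset.prod_eq_zero ?_
  rw [Multiset.map_map, Multiset.mem_map]
  exact ⟨x, hx, trekMap_X_of_not (by simpa using hno)⟩

variable {G : Digraph V}

theorem IsPolytree.trekMap_eq_zero_of_mem (hG : IsPolytree G)
    (hle : ∀ a b : V, a ≤ b ↔ Relation.ReflTransGen G.Adj a b) {f : MvPolynomial (MomentVar V) 𝕜}
    (hf : f ∈ linearGenerators 𝕜 G ∪ trekMinors 𝕜 G) : trekMap 𝕜 f = 0 := by
  have := hG.isPolyforest hle
  rcases hf with hf | ⟨i, j, -, c, d, rfl⟩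
  · obtain ⟨x, rfl, hx⟩ := hG.exists_of_mem_linearGenerators hle hf
    exact trekMap_X_of_not hx
  · obtain ⟨C, s, hC, h3, h4⟩ := hG.exists_isMeet_of_trekColumn hle c
    obtain ⟨D, t, hD, h6, h5⟩ := hG.exists_isMeet_of_trekColumn hle d
    have hX : ∀ x y : MomentVar V, monomial (Finsupp.single x 1 + Finsupp.single y 1) (1 : 𝕜) =
        X x * X y := fun x y => by
      rw [X, X, monomial_mul, one_mul]
    rw [det_trekMatrix, hX, hX, map_sub, map_mul, map_mul,
      trekMap_X_of_isMeet (x := trekEntry i c) ⟨s, by rwa [hC]⟩,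
      trekMap_X_of_isMeet (x := trekEntry j d) ⟨t, by rwa [hD]⟩,
      trekMap_X_of_isMeet (x := trekEntry j c) ⟨s, by rwa [hC]⟩,
      trekMap_X_of_isMeet (x := trekEntry i d) ⟨t, by rwa [hD]⟩,
      monomial_mul, monomial_mul, hC, hC, hD, hD, boxWeight_exchange h3 h4 h5 h6, sub_self]

theorem IsPolytree.eqvGen_of_weight_eq (𝕜 : Type*) [CommRing 𝕜] (hG : IsPolytree G)
    (hle : ∀ a b : V, a ≤ b ↔ Relation.ReflTransGen G.Adj a b) {u v : MomentVar V →₀ ℕ}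
    (hu : ∀ x ∈ Finsupp.toMultiset u, ∃ v, IsMeet (varBox x) v)
    (hv : ∀ x ∈ Finsupp.toMultiset v, ∃ v, IsMeet (varBox x) v)
    (h : weight ((Finsupp.toMultiset u).map varBox) = weight ((Finsupp.toMultiset v).map varBox)) :
    Relation.EqvGen (MarkovMove (linearGenerators 𝕜 G ∪ trekMinors 𝕜 G)) u v := by
  have := hG.isPolyforest hle
  refine (hG.eqvGen_markovMove 𝕜 hle (exchanges_of_weight_eq (isAdmissible_map_varBox hu)
    (isAdmissible_map_varBox hv) h)).mono ?_
  rintro u v ⟨a, b, c, hB, rfl, rfl⟩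
  exact ⟨a, b, c, Or.inr hB, rfl, rfl⟩

/-- The kernel of the monomial parametrization is the trek ideal. -/
theorem IsPolytree.ker_trekMap (hG : IsPolytree G)
    (hle : ∀ a b : V, a ≤ b ↔ Relation.ReflTransGen G.Adj a b) :
    RingHom.ker (trekMap (V := V) 𝕜) = trekIdeal 𝕜 G := by
  classical
  refine le_antisymm (fun f hf => ?_)
    (Ideal.span_le.2 fun f hf => hG.trekMap_eq_zero_of_mem hle hf)
  let P : (((ℕ × V) ⊕ (V × V)) →₀ ℕ) → (MomentVar V →₀ ℕ) → Prop := fun w u =>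
    (∀ x ∈ Finsupp.toMultiset u, ∃ v, IsMeet (varBox x) v) ∧
      weight ((Finsupp.toMultiset u).map varBox) = w
  -- A linear left inverse modulo the ideal: a monomial goes to the class of any monomial mapping to
  -- it. By connectivity the choice does not matter, so composing with `trekMap` gives the quotient
  -- map, and the kernel lies in the ideal.
  let ψ : MvPolynomial ((ℕ × V) ⊕ (V × V)) 𝕜 →ₗ[𝕜]
      MvPolynomial (MomentVar V) 𝕜 ⧸ trekIdeal 𝕜 G :=
    (basisMonomials ((ℕ × V) ⊕ (V × V)) 𝕜).constr 𝕜 fun w =>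
      if h : ∃ u, P w u then Ideal.Quotient.mk _ (monomial h.choose 1) else 0
  have hψ : ∀ w, ψ (monomial w 1) =
      if h : ∃ u, P w u then Ideal.Quotient.mk _ (monomial h.choose 1) else 0 := by
    intro w
    have := (basisMonomials ((ℕ × V) ⊕ (V × V)) 𝕜).constr_basis 𝕜 (fun w =>
      if h : ∃ u, P w u then Ideal.Quotient.mk (trekIdeal 𝕜 G) (monomial h.choose 1) else 0) w
    rwa [coe_basisMonomials] at this
  have hcomp : ψ ∘ₗ (trekMap (V := V) 𝕜).toLinearMap =
      (Ideal.Quotient.mkₐ 𝕜 (trekIdeal 𝕜 G)).toLinearMap := by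
    refine (basisMonomials (MomentVar V) 𝕜).ext fun u => ?_
    simp only [coe_basisMonomials]
    rw [LinearMap.comp_apply, AlgHom.toLinearMap_apply,
      AlgHom.toLinearMap_apply, Ideal.Quotient.mkₐ_eq_mk]
    by_cases hu : ∀ x ∈ Finsupp.toMultiset u, ∃ v, IsMeet (varBox x) v
    · have hex : ∃ u', P (weight ((Finsupp.toMultiset u).map varBox)) u' := ⟨u, hu, rfl⟩
      rw [trekMap_monomial hu, hψ, dif_pos hex, Ideal.Quotient.mk_eq_mk_iff_sub_mem]
      exact monomial_sub_mem_of_eqvGen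
        (hG.eqvGen_of_weight_eq 𝕜 hle hex.choose_spec.1 hu hex.choose_spec.2)
    · rw [trekMap_monomial_of_not hu, map_zero, eq_comm, Ideal.Quotient.eq_zero_iff_mem]
      push Not at hu
      obtain ⟨x, hx, hno⟩ := hu
      rw [monomial_one_eq_prod]
      exact Ideal.mem_of_dvd _ (Multiset.dvd_prod (Multiset.mem_map_of_mem X hx))
        (Ideal.subset_span (Or.inl (hG.X_mem_linearGenerators 𝕜 hle (by simpa using hno))))
  have := LinearMap.congr_fun hcomp f
  rw [LinearMap.comp_apply, AlgHom.toLinearMap_apply, AlgHom.toLinearMap_apply,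
    Ideal.Quotient.mkₐ_eq_mk, (RingHom.mem_ker).1 hf, map_zero, eq_comm,
    Ideal.Quotient.eq_zero_iff_mem] at this
  exact this

/-- The generators of the trek ideal are a Markov basis of it. -/
theorem IsPolytree.isMarkovBasis [Nontrivial 𝕜] (hG : IsPolytree G)
    (hle : ∀ a b : V, a ≤ b ↔ Relation.ReflTransGen G.Adj a b) :
    IsMarkovBasis (linearGenerators 𝕜 G ∪ trekMinors 𝕜 G) (trekIdeal 𝕜 G) := by
  refine ⟨fun f hf => ⟨Ideal.subset_span hf, ?_⟩, fun u hu => ?_, fun u v hu hv huv => ?_⟩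
  · rcases hf with hf | ⟨i, j, -, c, d, rfl⟩
    · obtain ⟨x, rfl, -⟩ := hG.exists_of_mem_linearGenerators hle hf
      exact Or.inl ⟨_, rfl⟩
    · exact Or.inr ⟨_, _, det_trekMatrix 𝕜 c d⟩
  · rw [← hG.ker_trekMap hle, RingHom.mem_ker] at hu
    -- A monomial whose indeterminates all have meets maps to a nonzero monomial, so it is not in
    -- the kernel.
    by_cases h : ∀ x ∈ Finsupp.toMultiset u, ∃ v, IsMeet (varBox x) v
    · change trekMap 𝕜 _ = 0 at hu
      rw [trekMap_monomial h, monomial_eq_zero] at hu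
      exact absurd hu one_ne_zero
    · push Not at h
      obtain ⟨x, hx, hno⟩ := h
      refine ⟨Finsupp.single x 1, ?_, Or.inl (hG.X_mem_linearGenerators 𝕜 hle (by simpa using hno))⟩
      rw [Finsupp.mem_toMultiset, Finsupp.mem_support_iff] at hx
      rw [Finsupp.single_le_iff]
      omega
  · have hgood : ∀ u : MomentVar V →₀ ℕ, monomial u (1 : 𝕜) ∉ trekIdeal 𝕜 G →
        ∀ x ∈ Finsupp.toMultiset u, ∃ v, IsMeet (varBox x) v := by
      intro u hu
      by_contra h
      rw [← hG.ker_trekMap hle, RingHom.mem_ker] at hu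
      exact hu (trekMap_monomial_of_not h)
    rw [← hG.ker_trekMap hle, RingHom.mem_ker] at huv
    change trekMap 𝕜 _ = 0 at huv
    rw [map_sub, trekMap_monomial (hgood u hu), trekMap_monomial (hgood v hv), sub_eq_zero] at huv
    exact hG.eqvGen_of_weight_eq 𝕜 hle (hgood u hu) (hgood v hv)
      (monomial_left_injective one_ne_zero huv)

end TrekMap

end ThirdMoment

namespace ThirdMoment

open MvPolynomial

/-! ### The inverse of `1 - Λ` and the simple trek rule -/

section PathMatrix

variable {V : Type*} [PartialOrder V] [Fintype V]

open Classical in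
/-- The product of the edge weights along the directed path from `s` to `i`, or zero if there is
no such path. -/
noncomputable def pathMatrix (Λ : Matrix V V ℝ) : Matrix V V ℝ :=
  Matrix.of fun s i => if s ≤ i then ∏ e ∈ pathEdges s i, Λ e.1 e.2 else 0

theorem pathMatrix_of_le (Λ : Matrix V V ℝ) {s i : V} (h : s ≤ i) :
    pathMatrix Λ s i = ∏ e ∈ pathEdges s i, Λ e.1 e.2 := by
  simp [pathMatrix, h]

theorem pathMatrix_of_not_le (Λ : Matrix V V ℝ) {s i : V} (h : ¬ s ≤ i) :
    pathMatrix Λ s i = 0 := by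
  simp [pathMatrix, h]

theorem pathMatrix_map_pow (Λ : Matrix V V ℝ) {m : ℕ} (hm : m ≠ 0) (s i : V) :
    pathMatrix (Λ.map (· ^ m)) s i = pathMatrix Λ s i ^ m := by
  by_cases h : s ≤ i
  · rw [pathMatrix_of_le _ h, pathMatrix_of_le _ h, ← Finset.prod_pow]
    rfl
  · rw [pathMatrix_of_not_le _ h, pathMatrix_of_not_le _ h, zero_pow hm]

theorem pathEdges_of_covBy {u i : V} (h : u ⋖ i) : pathEdges u i = {(u, i)} := by
  ext ⟨a, b⟩
  rw [mem_pathEdges, Finset.mem_singleton, Prod.mk.injEq]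
  constructor
  · rintro ⟨h1, h2, h3⟩
    have h2 : u ≤ a := h2
    have h3 : b ≤ i := h3
    have ha : a = u := by
      by_contra hne
      exact h.2 (lt_of_le_of_ne h2 (Ne.symm hne)) (h1.lt.trans_le h3)
    have hb : b = i := by
      by_contra hne
      exact h.2 (h2.trans_lt h1.lt) (lt_of_le_of_ne h3 hne)
    exact ⟨ha, hb⟩
  · rintro ⟨rfl, rfl⟩
    exact ⟨h, le_rfl, le_rfl⟩

variable [IsPolyforest V]

theorem pathMatrix_mul (Λ : Matrix V V ℝ) {s g i : V} (hs : s ≤ g) (hi : g ≤ i) :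
    pathMatrix Λ s i = pathMatrix Λ s g * pathMatrix Λ g i := by
  classical
  rw [pathMatrix_of_le _ hs, pathMatrix_of_le _ hi, pathMatrix_of_le _ (hs.trans hi),
    pathEdges_eq_union hs hi, Finset.prod_union (disjoint_pathEdges s g i)]

/-- For `s < i`, exactly one parent `u` of `i` lies above `s`, and its term, the path weight to `u`
times `Λ u i`, cancels the path weight to `i`. -/
theorem pathMatrix_mul_one_sub [DecidableEq V] {Λ : Matrix V V ℝ}
    (hΛ : ∀ i j, ¬ i ⋖ j → Λ i j = 0) : pathMatrix Λ * (1 - Λ) = 1 := by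
  ext s i
  rw [mul_sub, mul_one, Matrix.sub_apply, Matrix.mul_apply]
  by_cases hsi : s < i
  · obtain ⟨u, hsu, hui⟩ := exists_le_covBy_of_lt hsi
    rw [Finset.sum_eq_single u, pathMatrix_mul Λ hsu hui.le, pathMatrix_of_le _ hui.le,
      pathEdges_of_covBy hui, Finset.prod_singleton, sub_self, Matrix.one_apply_ne hsi.ne]
    · intro x _ hx
      by_cases hxi : x ⋖ i
      · rw [pathMatrix_of_not_le, zero_mul]
        intro hsx
        rcases comparable_of_mem_Icc hsx hsu hxi.le hui.le with h | h
        · exact hxi.2 (lt_of_le_of_ne h hx) hui.lt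
        · exact hui.2 (lt_of_le_of_ne h hx.symm) hxi.lt
      · rw [hΛ _ _ hxi, mul_zero]
    · simp
  · rw [Finset.sum_eq_zero, sub_zero]
    · by_cases h : s = i
      · subst h
        rw [pathMatrix_of_le _ le_rfl, pathEdges_self, Finset.prod_empty, Matrix.one_apply_eq]
      · rw [Matrix.one_apply_ne h, pathMatrix_of_not_le]
        exact fun hle => hsi (lt_of_le_of_ne hle h)
    · intro x _
      by_cases hxi : x ⋖ i
      · rw [pathMatrix_of_not_le, zero_mul]
        exact fun hsx => hsi (hsx.trans_lt hxi.lt)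
      · rw [hΛ _ _ hxi, mul_zero]

theorem inv_one_sub_eq_pathMatrix [DecidableEq V] {Λ : Matrix V V ℝ}
    (hΛ : ∀ i j, ¬ i ⋖ j → Λ i j = 0) : (1 - Λ)⁻¹ = pathMatrix Λ :=
  Matrix.inv_eq_left_inv (pathMatrix_mul_one_sub hΛ)

/-- The simple trek rule. -/
theorem sum_mul_prod_pathMatrix (Λ : Matrix V V ℝ) (ω : V → ℝ) {M : Multiset V} {v : V}
    (hM : M ≠ 0) (hv : IsMeet M v) :
    ∑ u, ω u * (M.map fun i => pathMatrix Λ u i).prod =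
      (∑ u, ω u * pathMatrix Λ u v ^ M.card) * (M.map fun i => pathMatrix Λ v i).prod := by
  rw [Finset.sum_mul]
  -- If `u ≤ v`, every path from `u` to an element of `M` factors through `v`; otherwise both sides
  -- vanish, as a common lower bound of `M` is below `v`.
  refine Finset.sum_congr rfl fun u _ => ?_
  by_cases huv : u ≤ v
  · rw [Multiset.map_congr rfl fun i hi => pathMatrix_mul Λ huv (hv.1 i hi), Multiset.prod_map_mul,
      Multiset.map_const', Multiset.prod_replicate, mul_assoc]
  · rw [pathMatrix_of_not_le Λ huv, zero_pow (Multiset.card_eq_zero.not.2 hM), mul_zero, zero_mul]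
    have : ∃ i ∈ M, ¬ u ≤ i := by
      by_contra! h
      exact huv (hv.2 u h)
    obtain ⟨i, hi, hui⟩ := this
    rw [Multiset.prod_eq_zero, mul_zero]
    exact Multiset.mem_map.2 ⟨i, hi, pathMatrix_of_not_le Λ hui⟩

theorem sum_mul_prod_pathMatrix_of_not (Λ : Matrix V V ℝ) (ω : V → ℝ) {M : Multiset V}
    (hM : M ≠ 0) (hv : ¬ ∃ v, IsMeet M v) :
    ∑ u, ω u * (M.map fun i => pathMatrix Λ u i).prod = 0 := by
  refine Finset.sum_eq_zero fun u _ => ?_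
  have : ∃ i ∈ M, ¬ u ≤ i := by
    by_contra! h
    exact hv (exists_isMeet hM h)
  obtain ⟨i, hi, hui⟩ := this
  rw [Multiset.prod_eq_zero, mul_zero]
  exact Multiset.mem_map.2 ⟨i, hi, pathMatrix_of_not_le Λ hui⟩

/-- The diagonal moments can be prescribed by the choice of the noise moments. -/
theorem sum_sub_mul_pathMatrix_pow {Λ : Matrix V V ℝ} (hΛ : ∀ i j, ¬ i ⋖ j → Λ i j = 0)
    {m : ℕ} (hm : m ≠ 0) (a : V → ℝ) (t : V) :
    ∑ u, (a u - ∑ p, a p * Λ p u ^ m) * pathMatrix Λ u t ^ m = a t := by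
  classical
  -- Entrywise `m`-th powers of path weights are path weights for the `m`-th powers of `Λ`. So the
  -- map from noise moments to diagonal moments has an explicit inverse.
  have h1 : pathMatrix (Λ.map (· ^ m)) * (1 - Λ.map (· ^ m)) = 1 :=
    pathMatrix_mul_one_sub fun i j h => by simp [hΛ i j h, hm]
  have h2 := mul_eq_one_comm.1 h1
  have h3 : Matrix.vecMul (Matrix.vecMul a (1 - Λ.map (· ^ m))) (pathMatrix (Λ.map (· ^ m))) = a := by
    rw [Matrix.vecMul_vecMul, h2, Matrix.vecMul_one]
  have h4 := congrFun h3 t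
  rw [Matrix.vecMul_sub, Matrix.vecMul_one] at h4
  simpa [Matrix.vecMul, dotProduct, pathMatrix_map_pow Λ hm] using h4

end PathMatrix

/-! ### The moment ideal as the kernel of the monomial map -/

section Parametrization

variable {V : Type*} [PartialOrder V] [Fintype V] [Nonempty V]

open Classical in
/-- The value of the monomial parametrization at the indeterminate `x`. -/
noncomputable def trekValue {R : Type*} [CommRing R] (θ : (ℕ × V) ⊕ (V × V) → R)
    (x : MomentVar V) : R :=
  if ∃ v, IsMeet (varBox x) v then
    θ (Sum.inl ((varBox x).card, meet (varBox x))) *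
      ((varBox x).map fun i => ∏ e ∈ pathEdges (meet (varBox x)) i, θ (Sum.inr e)).prod
  else 0

theorem eval_trekMap_X {R : Type*} [CommRing R] (θ : (ℕ × V) ⊕ (V × V) → R) (x : MomentVar V) :
    eval θ (trekMap R (X x)) = trekValue θ x := by
  by_cases h : ∃ v, IsMeet (varBox x) v
  · have hprod : ∀ (s : V) (C : Multiset V),
        eval θ (monomial (C.map fun i => ∑ e ∈ pathEdges s i, Finsupp.single (Sum.inr e) 1).sum 1) =
          (C.map fun i => ∏ e ∈ pathEdges s i, θ (Sum.inr e)).prod := by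
      intro s C
      induction C using Multiset.induction_on with
      | empty => simp
      | cons i C ih =>
        rw [Multiset.map_cons, Multiset.sum_cons, Multiset.map_cons, Multiset.prod_cons, ← ih,
          ← one_mul (1 : R), ← monomial_mul, map_mul, monomial_sum_one, map_prod]
        simp [eval_monomial]
    rw [trekMap_X_of_isMeet h, trekValue, if_pos h, boxWeight, ← one_mul (1 : R), ← monomial_mul,
      map_mul, hprod]
    simp [eval_monomial]
  · rw [trekMap_X_of_not h, trekValue, if_neg h, map_zero]

theorem eval_trekMap {R : Type*} [CommRing R] (θ : (ℕ × V) ⊕ (V × V) → R)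
    (f : MvPolynomial (MomentVar V) R) : eval θ (trekMap R f) = eval (trekValue θ) f := by
  induction f using MvPolynomial.induction_on with
  | C a => simp [trekMap]
  | add p q hp hq => rw [map_add, map_add, map_add, hp, hq]
  | mul_X p x hp => rw [map_mul, map_mul, map_mul, hp, eval_trekMap_X, eval_X]

theorem trekValue_ofReal (𝕜 : Type*) [RCLike 𝕜] (t : (ℕ × V) ⊕ (V × V) → ℝ) (x : MomentVar V) :
    trekValue (fun p => (t p : 𝕜)) x = ((trekValue t x : ℝ) : 𝕜) := by
  unfold trekValue
  split_ifs
  · simp only [← RCLike.algebraMap_eq_ofReal, map_mul, map_multiset_prod, Multiset.map_map,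
      Function.comp_def, map_prod]
  · simp

variable [IsPolyforest V]

/-- The moments of the model in terms of the monomial parametrization. -/
theorem sum_eq_trekValue {Λ : Matrix V V ℝ} {ω : V → ℝ} {t : (ℕ × V) ⊕ (V × V) → ℝ}
    (hΛ : ∀ u c, u ⋖ c → t (Sum.inr (u, c)) = Λ u c) (x : MomentVar V)
    (hω : ∀ v, t (Sum.inl ((varBox x).card, v)) =
      ∑ u, ω u * pathMatrix Λ u v ^ (varBox x).card) :
    ∑ u, ω u * ((varBox x).map fun i => pathMatrix Λ u i).prod = trekValue t x := by
  have hne : varBox x ≠ 0 := by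
    intro h
    have := card_varBox x
    simp [h] at this
  by_cases h : ∃ v, IsMeet (varBox x) v
  · obtain ⟨v, hv⟩ := h
    rw [sum_mul_prod_pathMatrix Λ ω hne hv, trekValue, if_pos ⟨v, hv⟩, hv.meet_eq, hω]
    congr 2
    refine Multiset.map_congr rfl fun i hi => ?_
    rw [pathMatrix_of_le _ (hv.1 i hi)]
    exact Finset.prod_congr rfl fun e he => (hΛ _ _ (mem_pathEdges.1 he).1).symm
  · rw [sum_mul_prod_pathMatrix_of_not Λ ω hne h, trekValue, if_neg h]

variable [DecidableEq V]

omit [PartialOrder V] [Nonempty V] [IsPolyforest V] in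
theorem transpose_mul_diag_mul_apply (L Ω : Matrix V V ℝ) (hΩ : Ω.IsDiag) (i j : V) :
    (L.transpose * Ω * L) i j =
      ∑ u, Ω u u * ((varBox (sVar i j)).map fun x => L u x).prod := by
  obtain ⟨d, rfl⟩ : ∃ d, Ω = Matrix.diagonal d := ⟨_, hΩ.diagonal_diag.symm⟩
  rw [Matrix.mul_apply]
  refine Finset.sum_congr rfl fun u _ => ?_
  rw [Matrix.mul_diagonal, varBox_sVar]
  simp
  ring

omit [PartialOrder V] [Nonempty V] [IsPolyforest V] [DecidableEq V] in
theorem tucker_diag_apply (L : Matrix V V ℝ) (Ω : V → V → V → ℝ) (hΩ : IsDiagTensor Ω)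
    (i j k : V) :
    tucker Ω L L L i j k =
      ∑ u, Ω u u u * ((varBox (tVar i j k)).map fun x => L u x).prod := by
  refine Finset.sum_congr rfl fun u _ => ?_
  rw [Finset.sum_eq_single u, Finset.sum_eq_single u]
  · rw [varBox_tVar]
    simp
    ring
  · intro c _ hc
    rw [hΩ u u c fun h => hc h.2.symm]
    ring
  · simp
  · intro b _ hb
    refine Finset.sum_eq_zero fun c _ => ?_
    rw [hΩ u b c fun h => hb h.1.symm]
    ring
  · simp

variable {G : Digraph V} {𝕜 : Type*} [RCLike 𝕜]

/-- Every point of the model is a value of the monomial parametrization. -/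
theorem IsPolytree.exists_eq_trekValue (hG : IsPolytree G)
    (hle : ∀ a b : V, a ≤ b ↔ Relation.ReflTransGen G.Adj a b) {p : MomentVar V → 𝕜}
    (hp : p ∈ modelPoints 𝕜 G) : ∃ θ : (ℕ × V) ⊕ (V × V) → 𝕜, p = trekValue θ := by
  obtain ⟨⟨S, T⟩, ⟨Λ, Ω₂, Ω₃, hΛ, -, hΩ₂, hΩ₃, hS, hT⟩, hpS, hpT⟩ := hp
  have hΛ' : ∀ i j, ¬ i ⋖ j → Λ i j = 0 := fun i j h =>
    hΛ i j ((hG.covBy_iff_adj hle).not.1 h)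
  rw [inv_one_sub_eq_pathMatrix hΛ'] at hS hT
  -- The parameters are the diagonal moments and the edge weights. Boxes have size 2 or 3, so the
  -- default branch only matters for size 3.
  let t : (ℕ × V) ⊕ (V × V) → ℝ := Sum.elim
    (fun q => if q.1 = 2 then ∑ u, Ω₂ u u * pathMatrix Λ u q.2 ^ 2
      else ∑ u, Ω₃ u u u * pathMatrix Λ u q.2 ^ 3) fun e => Λ e.1 e.2
  refine ⟨fun q => (t q : 𝕜), funext fun x => ?_⟩
  rw [trekValue_ofReal]
  rcases eq_sVar_or_eq_tVar x with ⟨i, j, rfl⟩ | ⟨i, j, k, rfl⟩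
  · refine (hpS i j).trans (congrArg _ ?_)
    change S i j = _
    rw [show S = _ from hS, transpose_mul_diag_mul_apply _ _ hΩ₂, sum_eq_trekValue (Λ := Λ) (t := t) (fun _ _ _ => rfl)]
    intro v
    simp [t, varBox_sVar]
  · refine (hpT i j k).trans (congrArg _ ?_)
    change T i j k = _
    rw [show T = _ from hT, tucker_diag_apply _ _ hΩ₃,
      sum_eq_trekValue (Λ := Λ) (t := t) (ω := fun u => Ω₃ u u u)
        (fun _ _ _ => rfl)]
    intro v
    simp [t, varBox_tVar]

/-- If the edge weights are small and the variances are close to each other, then the value of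
the monomial parametrization lies in the model. -/
theorem IsPolytree.trekValue_mem_modelPoints (hG : IsPolytree G)
    (hle : ∀ a b : V, a ≤ b ↔ Relation.ReflTransGen G.Adj a b) {t : (ℕ × V) ⊕ (V × V) → ℝ}
    (ha : ∀ q, t (Sum.inl q) ∈ Set.Ioo (1 : ℝ) 2)
    (hl : ∀ e, t (Sum.inr e) ∈ Set.Ioo (0 : ℝ) (1 / (2 * (Fintype.card V + 1)))) :
    trekValue (fun q => (t q : 𝕜)) ∈ modelPoints 𝕜 G := by
  classical
  let Λ : Matrix V V ℝ := fun u c => if u ⋖ c then t (Sum.inr (u, c)) else 0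
  have hΛ : ∀ i j, ¬ i ⋖ j → Λ i j = 0 := fun i j h => if_neg h
  let ω₂ : V → ℝ := fun u => t (Sum.inl (2, u)) - ∑ p, t (Sum.inl (2, p)) * Λ p u ^ 2
  let ω₃ : V → ℝ := fun u => t (Sum.inl (3, u)) - ∑ p, t (Sum.inl (3, p)) * Λ p u ^ 3
  let Ω₃ : V → V → V → ℝ := fun i j k => if i = j ∧ j = k then ω₃ i else 0
  have hΩ₃ : IsDiagTensor Ω₃ := fun i j k h => if_neg h
  have hΩ₂ : (Matrix.diagonal ω₂).IsDiag := Matrix.isDiag_diagonal _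
  have hpos : ∀ u, 0 < ω₂ u := by
    intro u
    have hn : (0 : ℝ) < Fintype.card V + 1 := by positivity
    -- With `n = card V`: a diagonal moment below 2 and `Λ² ≤ 1 / (2 (n + 1))` bound each term by `1
    -- / (n + 1)`. The `n` terms sum to less than 1, which is less than the variance at `u`.
    have hterm : ∀ p ∈ Finset.univ, t (Sum.inl (2, p)) * Λ p u ^ 2 ≤ 1 / (Fintype.card V + 1) := by
      intro p _
      obtain ⟨h1, h2⟩ := ha (2, p)
      have hL : 0 ≤ Λ p u ∧ Λ p u ≤ 1 / (2 * (Fintype.card V + 1)) := by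
        by_cases h : p ⋖ u
        · simp only [Λ, if_pos h]
          exact ⟨(hl (p, u)).1.le, (hl (p, u)).2.le⟩
        · simp only [Λ, if_neg h]
          exact ⟨le_rfl, by positivity⟩
      have hε : (1 : ℝ) / (2 * (Fintype.card V + 1)) ≤ 1 := by
        rw [div_le_one (by positivity)]
        have : (0 : ℝ) ≤ Fintype.card V := by positivity
        linarith
      have hsq : Λ p u ^ 2 ≤ 1 / (2 * (Fintype.card V + 1)) := by nlinarith
      calc t (Sum.inl (2, p)) * Λ p u ^ 2 ≤ 2 * (1 / (2 * (Fintype.card V + 1))) :=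
            mul_le_mul h2.le hsq (by positivity) (by norm_num)
        _ = 1 / (Fintype.card V + 1) := by field_simp
    have hsum := Finset.sum_le_sum hterm
    rw [Finset.sum_const, Finset.card_univ, nsmul_eq_mul] at hsum
    have hlt : (Fintype.card V : ℝ) * (1 / (Fintype.card V + 1)) < 1 := by
      rw [mul_one_div, div_lt_one hn]
      linarith
    have := (ha (2, u)).1
    simp only [ω₂]
    linarith
  have htΛ : ∀ u c, u ⋖ c → t (Sum.inr (u, c)) = Λ u c := fun u c h => (if_pos h).symm
  refine ⟨(_, _), ⟨Λ, Matrix.diagonal ω₂, Ω₃, fun i j h => hΛ i j ((hG.covBy_iff_adj hle).not.2 h),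
    Matrix.PosDef.diagonal hpos, hΩ₂, hΩ₃, rfl, rfl⟩, ?_, ?_⟩
  · intro i j
    refine (trekValue_ofReal 𝕜 t _).trans (congrArg _ (Eq.symm ?_))
    change (((1 - Λ)⁻¹).transpose * Matrix.diagonal ω₂ * (1 - Λ)⁻¹) i j = _
    rw [inv_one_sub_eq_pathMatrix hΛ, transpose_mul_diag_mul_apply _ _ hΩ₂,
      sum_eq_trekValue (t := t) htΛ]
    intro v
    have := sum_sub_mul_pathMatrix_pow hΛ two_ne_zero (fun u => t (Sum.inl (2, u))) v
    simp only [Matrix.diagonal_apply_eq]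
    exact this.symm
  · intro i j k
    refine (trekValue_ofReal 𝕜 t _).trans (congrArg _ (Eq.symm ?_))
    change tucker Ω₃ (1 - Λ)⁻¹ (1 - Λ)⁻¹ (1 - Λ)⁻¹ i j k = _
    rw [inv_one_sub_eq_pathMatrix hΛ, tucker_diag_apply _ _ hΩ₃,
      sum_eq_trekValue (t := t) (ω := fun u => Ω₃ u u u) htΛ]
    intro v
    have := sum_sub_mul_pathMatrix_pow hΛ three_ne_zero (fun u => t (Sum.inl (3, u))) v
    simp only [Ω₃, and_self, if_true]
    exact this.symm

/-- The moment ideal is the kernel of the monomial parametrization. -/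
theorem IsPolytree.momentIdeal_eq_ker (hG : IsPolytree G)
    (hle : ∀ a b : V, a ≤ b ↔ Relation.ReflTransGen G.Adj a b) :
    momentIdeal 𝕜 G = RingHom.ker (trekMap (V := V) 𝕜) := by
  ext f
  rw [momentIdeal, mem_vanishingIdeal_iff, RingHom.mem_ker]
  constructor
  · intro hf
    -- A polynomial vanishing on a product of infinite sets is zero. Real intervals stay infinite
    -- inside `𝕜`, so real parameters suffice for `ℂ` as well.
    let s : (ℕ × V) ⊕ (V × V) → Set ℝ := Sum.elim (fun _ => Set.Ioo 1 2)
      fun _ => Set.Ioo 0 (1 / (2 * (Fintype.card V + 1)))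
    have hs : ∀ q, (s q).Infinite := by
      rintro (q | q)
      · exact Set.Ioo_infinite (by norm_num)
      · exact Set.Ioo_infinite (by positivity)
    refine funext_set (fun q => (fun r : ℝ => (r : 𝕜)) '' s q)
      (fun q => (hs q).image RCLike.ofReal_injective.injOn) fun θ hθ => ?_
    choose t ht htθ using fun q => hθ q trivial
    obtain rfl : (fun q => (t q : 𝕜)) = θ := funext htθ
    rw [map_zero]
    have := hf _ (hG.trekValue_mem_modelPoints (𝕜 := 𝕜) hle (fun q => ht (Sum.inl q))
      fun e => ht (Sum.inr e))
    exact (eval_trekMap _ f).trans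
      ((DFunLike.congr_fun (coe_aeval_eq_eval _) f).symm.trans this)
  · intro hf p hp
    obtain ⟨θ, rfl⟩ := hG.exists_eq_trekValue hle hp
    refine (DFunLike.congr_fun (coe_aeval_eq_eval _) f).trans ((eval_trekMap θ f).symm.trans ?_)
    rw [show trekMap 𝕜 f = 0 from hf, map_zero]

end Parametrization

end ThirdMoment

/-! ### Assembly -/

theorem mainTheorem1 {V : Type*} [Fintype V] [DecidableEq V] (𝕜 : Type*) [RCLike 𝕜]
    (G : Digraph V) (hG : ThirdMoment.IsPolytree G) :
    ThirdMoment.momentIdeal 𝕜 G = ThirdMoment.trekIdeal 𝕜 G ∧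
    (∀ f ∈ ThirdMoment.linearGenerators 𝕜 G, f.IsHomogeneous 1) ∧
    (∀ f ∈ ThirdMoment.trekMinors 𝕜 G, ThirdMoment.IsQuadraticBinomial f) ∧
    ThirdMoment.IsMarkovBasis
      (ThirdMoment.linearGenerators 𝕜 G ∪ ThirdMoment.trekMinors 𝕜 G)
      (ThirdMoment.momentIdeal 𝕜 G) := by
  let _ : PartialOrder V := ThirdMoment.reachOrder G hG.1
  have hle : ∀ a b : V, a ≤ b ↔ Relation.ReflTransGen G.Adj a b := fun _ _ => Iff.rfl
  have : ThirdMoment.IsPolyforest V := hG.isPolyforest hle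
  have : Nonempty V := hG.2.connected.nonempty
  have hideal : ThirdMoment.momentIdeal 𝕜 G = ThirdMoment.trekIdeal 𝕜 G :=
    (hG.momentIdeal_eq_ker hle).trans (hG.ker_trekMap hle)
  refine ⟨hideal, fun f hf => ?_, fun f hf => ?_, hideal ▸ hG.isMarkovBasis hle⟩
  · obtain ⟨x, rfl, -⟩ := hG.exists_of_mem_linearGenerators hle hf
    exact MvPolynomial.isHomogeneous_X 𝕜 x
  · obtain ⟨i, j, -, c, d, rfl⟩ := hf
    exact ⟨_, _, by simp [map_add], by simp [map_add], ThirdMoment.det_trekMatrix 𝕜 c d⟩
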